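/- Let $\ell>2$, let $\Gamma_\ell\subset\mathrm{PSL}_2(\mathbb R)$ be the Hecke triangle group generated by $S=\begin{pmatrix}0&1\\-1&0\end{pmatrix}$ and $T=\begin{pmatrix}1&\ell\\0&1\end{pmatrix}$, and let $\widetilde\Gamma=\langle\Gamma_\ell,Q\rangle\subset\mathrm{PGL}_2(\mathbb R)$ with $Q=\begin{pmatrix}0&1\\1&0\end{pmatrix}$. Let $\chi$ be a unitary representation of $\widetilde\Gamma$ on a finite-dimensional complex inner product space $V$. Put $$a_1=\begin{pmatrix}1&\ell\\0&1\end{pmatrix},\qquad a_2=\begin{pmatrix}\ell&1\\-1&0\end{pmatrix},\qquad J=\begin{pmatrix}-1&0\\0&1\end{pmatrix},$$ all of which represent elements of $\widetilde\Gamma$. For $s\in\mathbb C$, $g\in\widetilde\Gamma$, $f\colon I\to V$ with $I\subseteq\mathbb R$, and $x$ with $g.x\in I$, let $$\alpha_s(g^{-1})f(x)=|g'(x)|^s\,\chi(g^{-1})f(g.x).$$ Fix $s\in\mathbb C\setminus\{\tfrac12\}$ with $\operatorname{Re}s>0$ and fix a sign $\pm$. *Slow eigenfunctions.* Let $\mathcal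 L_s^{\mathrm{slow},\pm}=\alpha_s(a_2)+\alpha_s(a_1^{-1})\pm\alpha_s(a_2J)$, acting on real-analytic functions $(-1,\infty)\to V$, and let $\mathrm{SFE}_s^{\omega,\mathrm{as},\pm}$ be the space of real-analytic $\varphi\colon(-1,\infty)\to V$ such that $\varphi=\mathcal L_s^{\mathrm{slow},\pm}\varphi$ and, for some $c\in V$, $\varphi(x)=c\,x^{1-2s}+O(x^{-2s})$ as $x\to\infty$. *Fast eigenfunctions.* Let $E_1=(-1,1)$ and $E_2=(\ell-1,\infty)$. Let $\mathcal B(E_1)$ be the space of functions $E_1\to V$ that extend holomorphically to a complex neighborhood of $[-1,1]$. Let $\mathcal B(E_2)$ be the space of functions $f\colon E_2\to V$ that extend holomorphically, with respect to the action of weight $s$, to a neighborhood of $[\ell-1,\infty]$ in the Riemann sphere, i.e. $f(x)=x^{-2s}h(1/x)$ for $x\in E_2$ with $h$ holomorphic on a complex neighborhood of $[0,\tfrac1{\ell-1}]$. For such $f$ and $x\in(-1,\infty)$ let $$\mathcal L_{1,s}^{\mathrm{fast}}f(x)=\sum_{n\ge1}\alpha_s(a_1^{-n})f(x)\qquad\text{if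 }\operatorname{Re}s>\tfrac12,$$ and in general let it be the value at $t=s$ of the analytic continuation, to $\{\operatorname{Re}t>0,\ t\neq\tfrac12\}$, of $t\mapsto\sum_{n\ge1}\alpha_t(a_1^{-n})f_t(x)$ ($\operatorname{Re}t>\tfrac12$), where $f_t(y)=y^{-2t}h(1/y)$. Let $$\mathcal L_s^{\mathrm{fast},\pm}=\begin{pmatrix}\alpha_s(a_2)\pm\alpha_s(a_2J)&\mathcal L_{1,s}^{\mathrm{fast}}\\ \alpha_s(a_2)\pm\alpha_s(a_2J)&0\end{pmatrix},$$ and let $\mathrm{FFE}_s^\pm$ be the space of $f=(f_1,f_2)^\top\in\mathcal B(E_1)\oplus\mathcal B(E_2)$ with $f=\mathcal L_s^{\mathrm{fast},\pm}f$. **Theorem.** The vector spaces $\mathrm{FFE}_s^\pm$ and $\mathrm{SFE}_s^{\omega,\mathrm{as},\pm}$ are isomorphic. An isomorphism $\mathrm{FFE}_s^\pm\to\mathrm{SFE}_s^{\omega,\mathrm{as},\pm}$, $(f_1,f_2)^\top\mapsto\varphi$, is given by $$\varphi|_{(-1,1)}=f_1,\qquad \varphi|_{(\ell-1,\infty)}=\bigl(1+\mathcal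 L_{1,s}^{\mathrm{fast}}\bigr)f_2,$$ and its inverse $\varphi\mapsto(f_1,f_2)^\top$ is given by $$f_1=\varphi|_{(-1,1)},\qquad f_2=\bigl(1-\alpha_s(a_1^{-1})\bigr)\varphi|_{(\ell-1,\infty)}.$$ -/

import Mathlib

open Set Filter Asymptotics
open scoped MatrixGroups

noncomputable section

namespace HeckeTriangle

/-! ### The groups -/

/-- The class in `PGL(2, ℝ)` of the matrix with rows `(a, b)` and `(c, d)`. -/
def bmat (a b c d : ℝ) (h : a * d - b * c ≠ 0) : PGL(2, ℝ) :=
  Matrix.ProjGenLinGroup.mk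
    (Matrix.GeneralLinearGroup.mkOfDetNeZero !![a, b; c, d] (by rwa [Matrix.det_fin_two_of]))

lemma bmat_mul (a b c d a' b' c' d' : ℝ) (h : a * d - b * c ≠ 0) (h' : a' * d' - b' * c' ≠ 0) :
    bmat a b c d h * bmat a' b' c' d' h' =
      bmat (a * a' + b * c') (a * b' + b * d') (c * a' + d * c') (c * b' + d * d')
        (by
          have := mul_ne_zero h h'
          intro h0
          apply this
          rw [← h0]
          ring) := by
  unfold bmat
  rw [← map_mul]
  congr 1
  ext i j
  fin_cases i <;> fin_cases j <;>
    simp [Matrix.GeneralLinearGroup.mkOfDetNeZero, Matrix.mul_apply, Fin.sum_univ_two]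

/-- `S = (0, 1; -1, 0)`. -/
def elS : PGL(2, ℝ) := bmat 0 1 (-1) 0 (by norm_num)

/-- `T = (1, ℓ; 0, 1)`. -/
def elT (ℓ : ℝ) : PGL(2, ℝ) := bmat 1 ℓ 0 1 (by norm_num)

/-- `Q = (0, 1; 1, 0)`. -/
def elQ : PGL(2, ℝ) := bmat 0 1 1 0 (by norm_num)

/-- The Hecke triangle group `Γ_ℓ`, generated by `S` and `T` (inside `PGL(2, ℝ)`). -/
def heckeGroup (ℓ : ℝ) : Subgroup PGL(2, ℝ) := Subgroup.closure {elS, elT ℓ}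

/-- The underlying triangle group, generated by `Γ_ℓ` and `Q`. -/
def triangleGroup (ℓ : ℝ) : Subgroup PGL(2, ℝ) := heckeGroup ℓ ⊔ Subgroup.zpowers elQ

lemma elS_mem (ℓ : ℝ) : elS ∈ triangleGroup ℓ :=
  Subgroup.mem_sup_left (Subgroup.subset_closure (by simp))

lemma elT_mem (ℓ : ℝ) : elT ℓ ∈ triangleGroup ℓ :=
  Subgroup.mem_sup_left (Subgroup.subset_closure (by simp))

lemma elQ_mem (ℓ : ℝ) : elQ ∈ triangleGroup ℓ :=
  Subgroup.mem_sup_right (Subgroup.mem_zpowers _)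

/-- `a₁ = (1, ℓ; 0, 1)`. -/
def a₁ (ℓ : ℝ) : triangleGroup ℓ := ⟨bmat 1 ℓ 0 1 (by norm_num), elT_mem ℓ⟩

/-- `a₂ = (ℓ, 1; -1, 0)`. -/
def a₂ (ℓ : ℝ) : triangleGroup ℓ := ⟨bmat ℓ 1 (-1) 0 (by norm_num), by
  have h : elT ℓ * bmat ℓ 1 (-1) 0 (by norm_num) = elS := by
    simp only [elT, elS, bmat_mul]
    congr 1 <;> ring
  rw [← inv_mul_eq_iff_eq_mul.mpr h.symm]
  exact mul_mem (inv_mem (elT_mem ℓ)) (elS_mem ℓ)⟩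

/-- `J = (-1, 0; 0, 1)`. -/
def elJ (ℓ : ℝ) : triangleGroup ℓ := ⟨bmat (-1) 0 0 1 (by norm_num), by
  have h : elQ * elS = bmat (-1) 0 0 1 (by norm_num) := by
    simp only [elQ, elS, bmat_mul]
    congr 1 <;> ring
  rw [← h]
  exact mul_mem (elQ_mem ℓ) (elS_mem ℓ)⟩

/-! ### The action by fractional linear transformations and the action `α_s` -/

/-- The fractional linear transformation `g.x = (a x + b) / (c x + d)`; it is used only at points
with `c x + d ≠ 0`. -/
def moebius (g : PGL(2, ℝ)) : ℝ → ℝ :=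
  Quotient.liftOn' (s₁ := QuotientGroup.leftRel (Subgroup.center (GL (Fin 2) ℝ))) g
    (fun A x => (A.val 0 0 * x + A.val 0 1) / (A.val 1 0 * x + A.val 1 1)) (by
      intro A B hAB
      obtain ⟨u, rfl⟩ := Matrix.ProjGenLinGroup.mk_eq_mk_iff.mp
        (show Matrix.ProjGenLinGroup.mk A = Matrix.ProjGenLinGroup.mk B from Quotient.sound' hAB)
      funext x
      have hu : (u : ℝ) ≠ 0 := u.ne_zero
      simp only [Units.val_mul, Matrix.GeneralLinearGroup.coe_scalar, Matrix.scalar_apply,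
        Matrix.mul_diagonal]
      rw [← mul_div_mul_right _ _ hu]
      congr 1 <;> ring)

/-- The absolute value of the derivative,
`|g'(x)| = |a d - b c| / (c x + d) ^ 2`. -/
def absDeriv (g : PGL(2, ℝ)) : ℝ → ℝ :=
  Quotient.liftOn' (s₁ := QuotientGroup.leftRel (Subgroup.center (GL (Fin 2) ℝ))) g
    (fun A x => |A.val.det| / (A.val 1 0 * x + A.val 1 1) ^ 2) (by
      intro A B hAB
      obtain ⟨u, rfl⟩ := Matrix.ProjGenLinGroup.mk_eq_mk_iff.mp
        (show Matrix.ProjGenLinGroup.mk A = Matrix.ProjGenLinGroup.mk B from Quotient.sound' hAB)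
      funext x
      have hu : |(u : ℝ) ^ 2| ≠ 0 := abs_ne_zero.mpr (pow_ne_zero _ u.ne_zero)
      simp only [Units.val_mul, Matrix.GeneralLinearGroup.coe_scalar, Matrix.scalar_apply,
        Matrix.mul_diagonal, Matrix.det_mul, Matrix.det_diagonal, Fin.prod_univ_two]
      rw [← mul_div_mul_right _ _ hu, ← abs_mul, abs_of_nonneg (sq_nonneg (u : ℝ))]
      congr 1
      · congr 1; ring
      · ring)

lemma moebius_bmat (a b c d : ℝ) (h : a * d - b * c ≠ 0) (x : ℝ) :
    moebius (bmat a b c d h) x = (a * x + b) / (c * x + d) := rfl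

lemma absDeriv_bmat (a b c d : ℝ) (h : a * d - b * c ≠ 0) (x : ℝ) :
    absDeriv (bmat a b c d h) x = |a * d - b * c| / (c * x + d) ^ 2 := by
  have : absDeriv (bmat a b c d h) x = |(!![a, b; c, d] : Matrix _ _ ℝ).det| / (c * x + d) ^ 2 :=
    rfl
  rw [this, Matrix.det_fin_two_of]

section Functions

variable {V : Type*} [NormedAddCommGroup V]

/-- A function on a set `I` of reals, as a function on all of `ℝ` with the value `0` off `I`. -/
def zeroExt {I : Set ℝ} (f : I → V) (x : ℝ) : V :=
  open Classical in if h : x ∈ I then f ⟨x, h⟩ else 0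

@[simp]
lemma zeroExt_of_mem {I : Set ℝ} (f : I → V) {x : ℝ} (h : x ∈ I) : zeroExt f x = f ⟨x, h⟩ := by
  simp [zeroExt, h]

@[simp]
lemma zeroExt_zero {I : Set ℝ} : zeroExt (0 : I → V) = 0 := by
  funext x
  by_cases h : x ∈ I <;> simp [zeroExt, h]

lemma zeroExt_add {I : Set ℝ} (f g : I → V) : zeroExt (f + g) = zeroExt f + zeroExt g := by
  funext x
  by_cases h : x ∈ I <;> simp [zeroExt, h]

variable [InnerProductSpace ℂ V]

lemma zeroExt_smul {I : Set ℝ} (c : ℂ) (f : I → V) : zeroExt (c • f) = c • zeroExt f := by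
  funext x
  by_cases h : x ∈ I <;> simp [zeroExt, h]

variable {ℓ : ℝ}

/-- `α_s(g) f(x) = |(g⁻¹)'(x)| ^ s χ(g) f(g⁻¹.x)` for a function `f` on `I` and `g⁻¹.x ∈ I`. -/
def alpha (s : ℂ) (χ : triangleGroup ℓ →* (V ≃ₗᵢ[ℂ] V)) (g : triangleGroup ℓ) {I : Set ℝ}
    (f : I → V) (x : ℝ) : V :=
  ((absDeriv (g⁻¹ : triangleGroup ℓ) x : ℝ) : ℂ) ^ s •
    χ g (zeroExt f (moebius (g⁻¹ : triangleGroup ℓ) x))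

lemma alpha_zero (s : ℂ) (χ : triangleGroup ℓ →* (V ≃ₗᵢ[ℂ] V)) (g : triangleGroup ℓ) {I : Set ℝ}
    (x : ℝ) : alpha s χ g (0 : I → V) x = 0 := by
  simp [alpha]

lemma alpha_add (s : ℂ) (χ : triangleGroup ℓ →* (V ≃ₗᵢ[ℂ] V)) (g : triangleGroup ℓ) {I : Set ℝ}
    (f f' : I → V) (x : ℝ) : alpha s χ g (f + f') x = alpha s χ g f x + alpha s χ g f' x := by
  simp [alpha, zeroExt_add]

lemma alpha_smul (s : ℂ) (χ : triangleGroup ℓ →* (V ≃ₗᵢ[ℂ] V)) (g : triangleGroup ℓ) {I : Set ℝ}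
    (c : ℂ) (f : I → V) (x : ℝ) : alpha s χ g (c • f) x = c • alpha s χ g f x := by
  simp [alpha, zeroExt_smul, smul_comm c]

/-- `α_s(a₂) ± α_s(a₂ J)`, the sign being `ε`. -/
def hyp (s : ℂ) (χ : triangleGroup ℓ →* (V ≃ₗᵢ[ℂ] V)) (ε : ℤˣ) {I : Set ℝ} (f : I → V) (x : ℝ) :
    V :=
  alpha s χ (a₂ ℓ) f x + ((ε : ℤ) : ℂ) • alpha s χ (a₂ ℓ * elJ ℓ) f x

lemma hyp_zero (s : ℂ) (χ : triangleGroup ℓ →* (V ≃ₗᵢ[ℂ] V)) (ε : ℤˣ) {I : Set ℝ} (x : ℝ) :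
    hyp s χ ε (0 : I → V) x = 0 := by
  simp [hyp, alpha_zero]

lemma hyp_add (s : ℂ) (χ : triangleGroup ℓ →* (V ≃ₗᵢ[ℂ] V)) (ε : ℤˣ) {I : Set ℝ} (f f' : I → V)
    (x : ℝ) : hyp s χ ε (f + f') x = hyp s χ ε f x + hyp s χ ε f' x := by
  simp only [hyp, alpha_add, smul_add]
  abel

lemma hyp_smul (s : ℂ) (χ : triangleGroup ℓ →* (V ≃ₗᵢ[ℂ] V)) (ε : ℤˣ) {I : Set ℝ} (c : ℂ)
    (f : I → V) (x : ℝ) : hyp s χ ε (c • f) x = c • hyp s χ ε f x := by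
  simp only [hyp, alpha_smul, smul_add, smul_comm c]

/-! ### Slow eigenfunctions -/

/-- The slow transfer operator `α_s(a₂) + α_s(a₁⁻¹) ± α_s(a₂ J)` on functions on `(-1, ∞)`. -/
def slowOp (s : ℂ) (χ : triangleGroup ℓ →* (V ≃ₗᵢ[ℂ] V)) (ε : ℤˣ) (φ : Ioi (-1 : ℝ) → V) :
    Ioi (-1 : ℝ) → V :=
  fun x => hyp s χ ε φ x + alpha s χ (a₁ ℓ)⁻¹ φ x

/-- The space of real-analytic `φ : (-1, ∞) → V` with `φ = L_s^{slow,±} φ`. -/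
def SFE (s : ℂ) (χ : triangleGroup ℓ →* (V ≃ₗᵢ[ℂ] V)) (ε : ℤˣ) :
    Submodule ℂ (Ioi (-1 : ℝ) → V) where
  carrier := {φ | AnalyticOnNhd ℝ (zeroExt φ) (Ioi (-1 : ℝ)) ∧ φ = slowOp s χ ε φ}
  zero_mem' := by
    refine ⟨?_, ?_⟩
    · rw [zeroExt_zero]
      exact analyticOnNhd_const
    · funext x
      simp [slowOp, hyp_zero, alpha_zero]
  add_mem' := by
    rintro φ ψ ⟨h1, h2⟩ ⟨h1', h2'⟩
    refine ⟨?_, ?_⟩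
    · rw [zeroExt_add]
      exact h1.add h1'
    · funext x
      have e1 := congrFun h2 x
      have e2 := congrFun h2' x
      simp only [slowOp, hyp_add, alpha_add, Pi.add_apply] at e1 e2 ⊢
      nth_rewrite 1 [e1, e2]
      abel
  smul_mem' := by
    rintro c φ ⟨h1, h2⟩
    refine ⟨?_, ?_⟩
    · rw [zeroExt_smul]
      exact analyticOnNhd_const.smul h1
    · funext x
      have e1 := congrFun h2 x
      simp only [slowOp, hyp_smul, alpha_smul, Pi.smul_apply] at e1 ⊢
      nth_rewrite 1 [e1]
      rw [smul_add]

/-- The subspace of those `φ` with `φ(x) = c x ^ (1 - 2 s) + O(x ^ (-2 s))` as `x → ∞`, for some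
`c ∈ V`. -/
def SFEas (s : ℂ) (χ : triangleGroup ℓ →* (V ≃ₗᵢ[ℂ] V)) (ε : ℤˣ) :
    Submodule ℂ (Ioi (-1 : ℝ) → V) where
  carrier := {φ | φ ∈ SFE s χ ε ∧ ∃ c : V,
    (fun x : ℝ => zeroExt φ x - (x : ℂ) ^ (1 - 2 * s) • c) =O[atTop]
      (fun x : ℝ => (x : ℂ) ^ (-2 * s))}
  zero_mem' := ⟨zero_mem _, 0, by simpa using isBigO_zero _ _⟩
  add_mem' := by
    rintro φ ψ ⟨h1, c, h2⟩ ⟨h1', c', h2'⟩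
    refine ⟨add_mem h1 h1', c + c', (h2.add h2').congr_left fun x => ?_⟩
    rw [zeroExt_add, Pi.add_apply, smul_add]
    abel
  smul_mem' := by
    rintro k φ ⟨h1, c, h2⟩
    refine ⟨Submodule.smul_mem _ k h1, k • c, (h2.const_smul_left k).congr_left fun x => ?_⟩
    rw [zeroExt_smul, Pi.smul_apply, Pi.smul_apply, smul_sub, smul_comm k]

/-! ### The function spaces of the fast transfer operator

An element of an inductive limit of spaces of holomorphic functions on complex neighborhoods of the
closure of an interval is determined by its restriction to the interval; the limit is the space of
those functions on the interval that extend holomorphically to a neighborhood of the closure. -/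

/-- `𝓑(E₁)` for `E₁ = (-1, 1)`: the functions on `(-1, 1)` which extend holomorphically to an open
neighborhood of `[-1, 1]` in `ℂ`. -/
def holB₁ (V : Type*) [NormedAddCommGroup V] [InnerProductSpace ℂ V] :
    Submodule ℂ (Ioo (-1 : ℝ) 1 → V) where
  carrier := {f | ∃ (U : Set ℂ) (F : ℂ → V), IsOpen U ∧ (∀ x ∈ Icc (-1 : ℝ) 1, (x : ℂ) ∈ U) ∧
    DifferentiableOn ℂ F U ∧ ∀ x : Ioo (-1 : ℝ) 1, F ((x : ℝ) : ℂ) = f x}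
  zero_mem' := ⟨univ, 0, isOpen_univ, by simp, differentiableOn_const 0, by simp⟩
  add_mem' := by
    rintro f g ⟨U, F, h1, h2, h3, h4⟩ ⟨U', F', h1', h2', h3', h4'⟩
    refine ⟨U ∩ U', F + F', h1.inter h1', fun x hx => ⟨h2 x hx, h2' x hx⟩,
      (h3.mono inter_subset_left).add (h3'.mono inter_subset_right), fun x => ?_⟩
    simp [h4, h4']
  smul_mem' := by
    rintro c f ⟨U, F, h1, h2, h3, h4⟩
    exact ⟨U, c • F, h1, h2, h3.const_smul c, fun x => by simp [h4]⟩

/-- `𝓑(E₂)` for `E₂ = (ℓ - 1, ∞)`: the functions on `(ℓ - 1, ∞)` which extend holomorphically to a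
neighborhood of the closure `[ℓ - 1, ∞]` in the Riemann sphere. Holomorphy is with respect to the
action of weight `s`: in the coordinate `w = 1 / x` the function `w ^ (-2 s) f(1 / w)` on
`(0, 1 / (ℓ - 1))` extends holomorphically to an open neighborhood of `[0, 1 / (ℓ - 1)]` in `ℂ`. -/
def holB₂ (V : Type*) [NormedAddCommGroup V] [InnerProductSpace ℂ V] (ℓ : ℝ) (s : ℂ) :
    Submodule ℂ (Ioi (ℓ - 1) → V) where
  carrier := {f | ∃ (U : Set ℂ) (h : ℂ → V), IsOpen U ∧
    (∀ w ∈ Icc (0 : ℝ) (1 / (ℓ - 1)), (w : ℂ) ∈ U) ∧ DifferentiableOn ℂ h U ∧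
    ∀ w ∈ Ioo (0 : ℝ) (1 / (ℓ - 1)), h (w : ℂ) = (w : ℂ) ^ (-2 * s) • zeroExt f (1 / w)}
  zero_mem' := ⟨univ, 0, isOpen_univ, by simp, differentiableOn_const 0, by simp⟩
  add_mem' := by
    rintro f g ⟨U, F, h1, h2, h3, h4⟩ ⟨U', F', h1', h2', h3', h4'⟩
    refine ⟨U ∩ U', F + F', h1.inter h1', fun x hx => ⟨h2 x hx, h2' x hx⟩,
      (h3.mono inter_subset_left).add (h3'.mono inter_subset_right), fun w hw => ?_⟩
    rw [Pi.add_apply, h4 w hw, h4' w hw, zeroExt_add, Pi.add_apply, smul_add]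
  smul_mem' := by
    rintro c f ⟨U, F, h1, h2, h3, h4⟩
    refine ⟨U, c • F, h1, h2, h3.const_smul c, fun w hw => ?_⟩
    rw [Pi.smul_apply, h4 w hw, zeroExt_smul, Pi.smul_apply, smul_comm c]

/-! ### The fast transfer operator -/

/-- The half-plane `Re t > 0` without the point `1 / 2`. -/
def contDomain : Set ℂ := {t | 0 < t.re ∧ t ≠ 1 / 2}

/-- The function with the same expression in the coordinate `w = 1 / x` as `f`, but read at the
parameter `t` instead of `s`: if `f(x) = x ^ (-2 s) h(1 / x)`, then it is `x ^ (-2 t) h(1 / x)`. -/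
def changeParam (s t : ℂ) (f : Ioi (ℓ - 1) → V) : Ioi (ℓ - 1) → V :=
  fun x => ((x : ℝ) : ℂ) ^ (-2 * (t - s)) • f x

/-- `HasFastOne s χ f x v` says that `L_{1,s}^{fast} f (x)` is defined and equals `v`:
`v` is the value at `s` of the analytic continuation to `Re t > 0`, `t ≠ 1 / 2`, of the map
`t ↦ ∑_{n ≥ 1} α_t(a₁⁻ⁿ) f (x)`, `Re t > 1 / 2`, where the expression of `f` in the coordinate
`1 / x` at `∞` is kept fixed. The continuation is unique, see `HasFastOne.unique`, and for
`Re s > 1 / 2` the value is the sum itself, see `HasFastOne.hasSum`. -/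
def HasFastOne (s : ℂ) (χ : triangleGroup ℓ →* (V ≃ₗᵢ[ℂ] V)) (f : Ioi (ℓ - 1) → V) (x : ℝ)
    (v : V) : Prop :=
  ∃ F : ℂ → V, DifferentiableOn ℂ F contDomain ∧
    (∀ t : ℂ, 1 / 2 < t.re →
      HasSum (fun n : ℕ => alpha t χ ((a₁ ℓ)⁻¹ ^ (n + 1)) (changeParam s t f) x) (F t)) ∧
    F s = v

lemma changeParam_self (s : ℂ) (f : Ioi (ℓ - 1) → V) : changeParam s s f = f := by
  funext x
  simp [changeParam]

lemma HasFastOne.hasSum {s : ℂ} (hs : 1 / 2 < s.re)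
    {χ : triangleGroup ℓ →* (V ≃ₗᵢ[ℂ] V)} {f : Ioi (ℓ - 1) → V} {x : ℝ} {v : V}
    (h : HasFastOne s χ f x v) :
    HasSum (fun n : ℕ => alpha s χ ((a₁ ℓ)⁻¹ ^ (n + 1)) f x) v := by
  obtain ⟨F, -, h2, rfl⟩ := h
  have := h2 s hs
  rwa [changeParam_self] at this

lemma HasFastOne.unique [FiniteDimensional ℂ V] {s : ℂ} (hs : 0 < s.re) (hs' : s ≠ 1 / 2)
    {χ : triangleGroup ℓ →* (V ≃ₗᵢ[ℂ] V)} {f : Ioi (ℓ - 1) → V} {x : ℝ} {v v' : V}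
    (h : HasFastOne s χ f x v) (h' : HasFastOne s χ f x v') : v = v' := by
  obtain ⟨F, h1, h2, rfl⟩ := h
  obtain ⟨F', h1', h2', rfl⟩ := h'
  have hopen : IsOpen contDomain :=
    (isOpen_lt continuous_const Complex.continuous_re).inter isOpen_ne
  have hconv : ∀ {W : Set ℂ}, Convex ℝ W → IsPreconnected W := fun h => h.isPreconnected
  have hconn : IsPreconnected contDomain := by
    have e : contDomain =
        ((({t : ℂ | 1 / 2 < t.re}) ∪ ({t : ℂ | 0 < t.re} ∩ {t : ℂ | 0 < t.im})) ∪
          ({t : ℂ | 0 < t.re} ∩ {t : ℂ | t.im < 0})) ∪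
          ({t : ℂ | 0 < t.re} ∩ {t : ℂ | t.re < 1 / 2}) := by
      ext t
      simp only [contDomain, mem_ofPred_eq, mem_union, mem_inter_iff, ne_eq, Complex.ext_iff]
      norm_num
      constructor
      · rintro ⟨h0, h⟩
        rcases lt_trichotomy t.re (1 / 2) with h3 | h3 | h3
        · exact Or.inr ⟨h0, h3⟩
        · rcases lt_trichotomy t.im 0 with h4 | h4 | h4
          · exact Or.inl (Or.inr ⟨h0, h4⟩)
          · exact absurd h4 (h h3)
          · exact Or.inl (Or.inl (Or.inr ⟨h0, h4⟩))
        · exact Or.inl (Or.inl (Or.inl h3))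
      · rintro (((h | ⟨h, h3⟩) | ⟨h, h3⟩) | ⟨h, h3⟩)
        · exact ⟨by linarith, fun h4 => by linarith⟩
        · exact ⟨h, fun _ => h3.ne'⟩
        · exact ⟨h, fun _ => h3.ne⟩
        · exact ⟨h, fun h4 => by linarith⟩
    rw [e]
    refine IsPreconnected.union (⟨1 / 4, 1⟩ : ℂ) ?_ ?_ (IsPreconnected.union (⟨1, -1⟩ : ℂ) ?_ ?_
      (IsPreconnected.union (⟨1, 1⟩ : ℂ) ?_ ?_ ?_ ?_) ?_) ?_
    · refine Or.inl (Or.inr ⟨?_, ?_⟩) <;> simp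
    · constructor <;> norm_num
    · refine Or.inl ?_
      norm_num
    · constructor <;> norm_num
    · norm_num
    · constructor <;> norm_num
    · exact hconv (convex_halfSpace_re_gt _)
    · exact hconv ((convex_halfSpace_re_gt _).inter (convex_halfSpace_im_gt _))
    · exact hconv ((convex_halfSpace_re_gt _).inter (convex_halfSpace_im_lt _))
    · exact hconv ((convex_halfSpace_re_gt _).inter (convex_halfSpace_re_lt _))
  have : CompleteSpace V := FiniteDimensional.complete ℂ V
  have hmem : (1 : ℂ) ∈ contDomain := by
    constructor <;> norm_num
  refine (h1.analyticOnNhd hopen).eqOn_of_preconnected_of_eventuallyEq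
    (h1'.analyticOnNhd hopen) hconn hmem ?_ ⟨hs, hs'⟩
  have hn : {t : ℂ | 1 / 2 < t.re} ∈ nhds (1 : ℂ) :=
    (isOpen_lt continuous_const Complex.continuous_re).mem_nhds (by norm_num)
  filter_upwards [hn] with t ht
  exact (h2 t ht).unique (h2' t ht)

lemma HasFastOne.zero (s : ℂ) (χ : triangleGroup ℓ →* (V ≃ₗᵢ[ℂ] V)) (x : ℝ) :
    HasFastOne s χ (0 : Ioi (ℓ - 1) → V) x 0 := by
  refine ⟨0, differentiableOn_const 0, fun t _ => ?_, rfl⟩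
  have h : changeParam s t (0 : Ioi (ℓ - 1) → V) = 0 := by
    funext y
    simp [changeParam]
  simp only [h, alpha_zero]
  exact hasSum_zero

lemma HasFastOne.add {s : ℂ} {χ : triangleGroup ℓ →* (V ≃ₗᵢ[ℂ] V)} {f f' : Ioi (ℓ - 1) → V}
    {x : ℝ} {v v' : V} (h : HasFastOne s χ f x v) (h' : HasFastOne s χ f' x v') :
    HasFastOne s χ (f + f') x (v + v') := by
  obtain ⟨F, h1, h2, rfl⟩ := h
  obtain ⟨F', h1', h2', rfl⟩ := h'
  refine ⟨F + F', h1.add h1', fun t ht => ?_, rfl⟩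
  have h : changeParam s t (f + f') = changeParam s t f + changeParam s t f' := by
    funext y
    simp [changeParam]
  simp only [h, alpha_add]
  exact (h2 t ht).add (h2' t ht)

lemma HasFastOne.smul {s : ℂ} {χ : triangleGroup ℓ →* (V ≃ₗᵢ[ℂ] V)} {f : Ioi (ℓ - 1) → V}
    {x : ℝ} {v : V} (c : ℂ) (h : HasFastOne s χ f x v) :
    HasFastOne s χ (c • f) x (c • v) := by
  obtain ⟨F, h1, h2, rfl⟩ := h
  refine ⟨c • F, h1.const_smul c, fun t ht => ?_, rfl⟩
  have h : changeParam s t (c • f) = c • changeParam s t f := by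
    funext y
    simp [changeParam, smul_comm c]
  simp only [h, alpha_smul]
  exact (h2 t ht).const_smul c

/-- `HasFast s χ ε f g` says that `L_s^{fast,±} f` is defined and equals `g`, where `L_s^{fast,±}`
is the matrix operator with rows `(α_s(a₂) ± α_s(a₂ J), L_{1,s}^{fast})` and
`(α_s(a₂) ± α_s(a₂ J), 0)`. -/
def HasFast (s : ℂ) (χ : triangleGroup ℓ →* (V ≃ₗᵢ[ℂ] V)) (ε : ℤˣ)
    (f g : (Ioo (-1 : ℝ) 1 → V) × (Ioi (ℓ - 1) → V)) : Prop :=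
  (∀ x : Ioo (-1 : ℝ) 1, ∃ v : V, HasFastOne s χ f.2 x v ∧ g.1 x = hyp s χ ε f.1 x + v) ∧
    ∀ x : Ioi (ℓ - 1), g.2 x = hyp s χ ε f.1 x

/-- The space of `f = (f₁, f₂) ∈ 𝓑(E₁) ⊕ 𝓑(E₂)` with `f = L_s^{fast,±} f`. -/
def FFE (s : ℂ) (χ : triangleGroup ℓ →* (V ≃ₗᵢ[ℂ] V)) (ε : ℤˣ) :
    Submodule ℂ ((Ioo (-1 : ℝ) 1 → V) × (Ioi (ℓ - 1) → V)) where
  carrier := {f | f ∈ (holB₁ V).prod (holB₂ V ℓ s) ∧ HasFast s χ ε f f}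
  zero_mem' := ⟨zero_mem _, fun x => ⟨0, HasFastOne.zero s χ x, by simp [hyp_zero]⟩,
    fun x => by simp [hyp_zero]⟩
  add_mem' := by
    rintro f g ⟨h1, h2, h3⟩ ⟨h1', h2', h3'⟩
    refine ⟨add_mem h1 h1', fun x => ?_, fun x => ?_⟩
    · obtain ⟨v, hv, e⟩ := h2 x
      obtain ⟨v', hv', e'⟩ := h2' x
      refine ⟨v + v', hv.add hv', ?_⟩
      rw [Prod.fst_add, Pi.add_apply, hyp_add, e, e']
      abel
    · rw [Prod.snd_add, Pi.add_apply, Prod.fst_add, hyp_add, h3 x, h3' x]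
  smul_mem' := by
    rintro c f ⟨h1, h2, h3⟩
    refine ⟨Submodule.smul_mem _ c h1, fun x => ?_, fun x => ?_⟩
    · obtain ⟨v, hv, e⟩ := h2 x
      refine ⟨c • v, hv.smul c, ?_⟩
      rw [Prod.smul_fst, Pi.smul_apply, hyp_smul, e, smul_add]
    · rw [Prod.smul_snd, Pi.smul_apply, Prod.smul_fst, hyp_smul, h3 x]

end Functions

end HeckeTriangle

end

open HeckeTriangle

/-!
Write `U = χ(a₁⁻¹)`, so that `α_s(a₁⁻¹) f(x) = U f(x + ℓ)`, and `H = α_s(a₂) ± α_s(a₂ J)`. For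
`x > -1` the points `± 1 / (x + ℓ)` lie in `(-1, 1)`, so `H f` on `(-1, ∞)` only reads `f` on
`(-1, 1)` (`hyp_congr`). The slow equation is `φ(x) = H φ(x) + U φ(x + ℓ)`. If
`f₂ = (1 - α_s(a₁⁻¹)) φ = H φ`, then iterating gives formally `φ = ∑_{n ≥ 0} Uⁿ f₂(x + n ℓ)`, that
is `φ = (1 + L) f₂` with `L = L_{1,s}^{fast}`. Conversely a fast eigenfunction gives
`φ = H f₁ + L f₂` on the whole of `(-1, ∞)` (`toSlow`), and the slow equation follows from
`L f(x) = U (f(x + ℓ) + L f(x + ℓ))` (`fastOne_eq_map_add`). Three points need an argument.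

* The operator `L` is defined on all of `𝓑(E₂)`, with real-analytic values that are
  `c x ^ (1 - 2 s) + O(x ^ (-2 s))`. Let `f_t(y) = y ^ (-2 t) h(1 / y)` and write
  `h(0) = p + U q - q` with `U p = p`, as is possible for a unitary operator
  (`exists_eq_add_map_sub`). Then
  `D_t(y) = y ^ (1 - 2 t) / (ℓ (1 - 2 t)) p + y ^ (-2 t) q` satisfies
  `U D_t(y + ℓ) - D_t(y) = f_t(y) + O(|y| ^ (-2 Re t - 1))` (`norm_approxErr_le`). Summing over
  `y = x + n ℓ` replaces the series by `- U D_t(x + ℓ)` and a series which converges for `Re t > 0`,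
  locally uniformly in `t` and `x`; this is the continuation, with the only pole `t = 1 / 2`
  (`HurwitzData.differentiableOn_param`, `HurwitzData.hasSum`), and its asymptotics can be read off
  (`HurwitzData.isBigO`). It is constructed for large `x` only; the functional equation of `L`
  carries it to `x > -1` (`HasFastOne.of_add`).

* The identity `φ = (1 + L) f₂` holds for a slow eigenfunction with the required asymptotics:
  the difference `ψ` satisfies `ψ(x) = U ψ(x + ℓ)` and has the same kind of asymptotics, and as
  `U` is unitary, `Re s > 0` and `s ≠ 1 / 2`, this forces `ψ = 0` (`eq_zero_of_quasiperiodic`).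

* The restriction of a slow eigenfunction to `(-1, 1)` lies in `𝓑(E₁)`: the right-hand side of the
  slow equation is real-analytic also at `x = -1`, since `ℓ > 2`, and a function which is
  real-analytic on a compact interval extends to a complex neighborhood
  (`exists_holomorphic_extension`). Then `f₂ = H f₁` lies in `𝓑(E₂)` (`hyp_mem_holB₂`).
-/

noncomputable section

namespace HeckeTriangle

/-! ### Explicit formulas for the operators -/

section Formulas

variable {V : Type*} [NormedAddCommGroup V] [InnerProductSpace ℂ V] {ℓ : ℝ}

lemma bmat_one : bmat 1 0 0 1 (by norm_num) = 1 := by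
  rw [← map_one Matrix.ProjGenLinGroup.mk, bmat]
  congr 1
  ext i j
  fin_cases i <;> fin_cases j <;> simp [Matrix.GeneralLinearGroup.mkOfDetNeZero]

lemma coe_a₁_pow (ℓ : ℝ) (k : ℕ) :
    ((a₁ ℓ ^ k : triangleGroup ℓ) : PGL(2, ℝ)) = bmat 1 (k * ℓ) 0 1 (by norm_num) := by
  induction k with
  | zero =>
    simp only [pow_zero, Nat.cast_zero, zero_mul, Subgroup.coe_one, bmat_one]
  | succ k ih =>
    rw [pow_succ, Subgroup.coe_mul, ih, a₁, bmat_mul]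
    congr 1 <;> push_cast <;> ring

lemma inv_eq_bmat {g : PGL(2, ℝ)} {a b c d : ℝ} (h : a * d - b * c ≠ 0)
    (hg : g * bmat a b c d h = 1) : g⁻¹ = bmat a b c d h :=
  inv_eq_of_mul_eq_one_right hg

lemma coe_a₂_inv (ℓ : ℝ) : ((a₂ ℓ)⁻¹ : triangleGroup ℓ) = bmat 0 (-1) 1 ℓ (by norm_num) := by
  rw [Subgroup.coe_inv]
  refine inv_eq_bmat _ ?_
  rw [a₂, bmat_mul, ← bmat_one]
  congr 1 <;> ring

lemma coe_a₂_mul_elJ_inv (ℓ : ℝ) :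
    ((a₂ ℓ * elJ ℓ)⁻¹ : triangleGroup ℓ) = bmat 0 1 1 ℓ (by norm_num) := by
  rw [Subgroup.coe_inv]
  refine inv_eq_bmat _ ?_
  rw [Subgroup.coe_mul, a₂, elJ, bmat_mul, bmat_mul, ← bmat_one]
  congr 1 <;> ring

lemma alpha_a₁_inv_pow (s : ℂ) (χ : triangleGroup ℓ →* (V ≃ₗᵢ[ℂ] V)) {I : Set ℝ} (f : I → V)
    (n : ℕ) (x : ℝ) :
    alpha s χ ((a₁ ℓ)⁻¹ ^ n) f x = ((χ (a₁ ℓ)⁻¹) ^ n) (zeroExt f (x + n * ℓ)) := by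
  have h : (((a₁ ℓ)⁻¹ ^ n)⁻¹ : triangleGroup ℓ) = a₁ ℓ ^ n := by simp
  rw [alpha, h, coe_a₁_pow, absDeriv_bmat, moebius_bmat, map_pow]
  simp

lemma alpha_a₁_inv (s : ℂ) (χ : triangleGroup ℓ →* (V ≃ₗᵢ[ℂ] V)) {I : Set ℝ} (f : I → V)
    (x : ℝ) : alpha s χ (a₁ ℓ)⁻¹ f x = χ (a₁ ℓ)⁻¹ (zeroExt f (x + ℓ)) := by
  simpa using alpha_a₁_inv_pow s χ f 1 x

lemma ofReal_one_div_sq_cpow {y : ℝ} (hy : 0 < y) (s : ℂ) :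
    ((1 / y ^ 2 : ℝ) : ℂ) ^ s = (y : ℂ) ^ (-2 * s) := by
  have hy' : (y : ℂ) ≠ 0 := by exact_mod_cast hy.ne'
  have h2 : ((1 / y ^ 2 : ℝ) : ℂ) ≠ 0 := by
    exact_mod_cast (by positivity : (1 / y ^ 2 : ℝ) ≠ 0)
  rw [Complex.cpow_def_of_ne_zero h2, Complex.cpow_def_of_ne_zero hy',
    ← Complex.ofReal_log (by positivity), ← Complex.ofReal_log hy.le, one_div, Real.log_inv,
    Real.log_pow]
  congr 1
  push_cast
  ring

lemma hyp_eq (s : ℂ) (χ : triangleGroup ℓ →* (V ≃ₗᵢ[ℂ] V)) (ε : ℤˣ) {I : Set ℝ} (f : I → V)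
    {x : ℝ} (hx : 0 < x + ℓ) :
    hyp s χ ε f x = ((x + ℓ : ℝ) : ℂ) ^ (-2 * s) •
      (χ (a₂ ℓ) (zeroExt f (-1 / (x + ℓ))) +
        ((ε : ℤ) : ℂ) • χ (a₂ ℓ * elJ ℓ) (zeroExt f (1 / (x + ℓ)))) := by
  rw [hyp, alpha, alpha, coe_a₂_inv, coe_a₂_mul_elJ_inv, absDeriv_bmat, absDeriv_bmat,
    moebius_bmat, moebius_bmat, ← ofReal_one_div_sq_cpow hx, smul_add, smul_comm _ ((ε : ℤ) : ℂ)]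
  simp

/-- `α_s(a₂) ± α_s(a₂ J)` only reads `f` on `(-1, 1)`. -/
lemma hyp_congr (s : ℂ) (χ : triangleGroup ℓ →* (V ≃ₗᵢ[ℂ] V)) (ε : ℤˣ) {I I' : Set ℝ}
    {f : I → V} {f' : I' → V} (h : ∀ y ∈ Ioo (-1 : ℝ) 1, zeroExt f y = zeroExt f' y)
    {x : ℝ} (hx : 1 < x + ℓ) : hyp s χ ε f x = hyp s χ ε f' x := by
  have h0 : 0 < x + ℓ := by linarith
  have h1 : 1 / (x + ℓ) < 1 := by rwa [div_lt_one h0]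
  have h2 : 0 < 1 / (x + ℓ) := by positivity
  rw [hyp_eq s χ ε f h0, hyp_eq s χ ε f' h0, h _ ⟨by linarith, h1⟩,
    h (-1 / (x + ℓ)) ⟨by rw [neg_div]; linarith, by rw [neg_div]; linarith⟩]

end Formulas

/-! ### Real-analytic and holomorphic functions -/

section Complexification

variable {W : Type*} [NormedAddCommGroup W] [NormedSpace ℂ W]

/-- The restriction of a holomorphic function to the real line is real-analytic. -/
lemma analyticAt_comp_ofReal_of_differentiableOn [CompleteSpace W] {U : Set ℂ} (hU : IsOpen U)
    {F : ℂ → W} (hF : DifferentiableOn ℂ F U) {x : ℝ} (hx : (x : ℂ) ∈ U) :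
    AnalyticAt ℝ (fun y : ℝ => F y) x :=
  (hF.analyticOnNhd hU x hx).restrictScalars.comp (Complex.ofRealCLM.analyticAt x)

lemma analyticAt_cpow_const {r : ℝ → ℝ} {x : ℝ} (hr : AnalyticAt ℝ r x) (hx : 0 < r x) (s : ℂ) :
    AnalyticAt ℝ (fun y => ((r y : ℝ) : ℂ) ^ s) x := by
  have h : AnalyticAt ℂ (fun z : ℂ => z ^ s) (r x : ℂ) :=
    analyticAt_id.cpow analyticAt_const (Complex.ofReal_mem_slitPlane.mpr hx)
  exact h.restrictScalars.comp_of_eq ((Complex.ofRealCLM.analyticAt _).comp hr) rfl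

/-- The Taylor series of a real-analytic function converges on a complex disc. -/
lemma exists_holomorphic_extension_disc [CompleteSpace W] {g : ℝ → W} {x : ℝ}
    (hg : AnalyticAt ℝ g x) :
    ∃ r > 0, ∃ F : ℂ → W, DifferentiableOn ℂ F (Metric.ball (x : ℂ) r) ∧
      ∀ y : ℝ, (y : ℂ) ∈ Metric.ball (x : ℂ) r → F y = g y := by
  obtain ⟨p, R, hp⟩ := hg
  obtain ⟨ρ, hρ0, hρ⟩ : ∃ ρ : NNReal, 0 < ρ ∧ (ρ : ENNReal) < R := by
    obtain ⟨ρ, h1, h2⟩ := ENNReal.lt_iff_exists_nnreal_btwn.mp hp.r_pos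
    exact ⟨ρ, by exact_mod_cast h1, h2⟩
  obtain ⟨C, hC0, hC⟩ := p.norm_mul_pow_le_of_lt_radius (hρ.trans_le hp.r_le)
  have hρ0' : (0 : ℝ) < ρ := hρ0
  refine ⟨ρ / 2, by positivity, fun z => ∑' n : ℕ, (z - x) ^ n • p.coeff n, ?_, ?_⟩
  · refine Complex.differentiableOn_tsum_of_summable_norm (u := fun n => C * (1 / 2) ^ n)
      (summable_geometric_two.mul_left C) (fun n => ?_) Metric.isOpen_ball fun n z hz => ?_
    · fun_prop
    · have hz' : ‖z - x‖ ≤ ρ / 2 := by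
        rw [← dist_eq_norm]
        exact (Metric.mem_ball.mp hz).le
      have hn : ‖p.coeff n‖ ≤ ‖p n‖ := by
        simp
      calc ‖(z - x) ^ n • p.coeff n‖ = ‖z - x‖ ^ n * ‖p.coeff n‖ := by
            rw [norm_smul, norm_pow]
        _ ≤ (ρ / 2) ^ n * ‖p n‖ := by gcongr
        _ = (‖p n‖ * ρ ^ n) * (1 / 2) ^ n := by
            rw [div_pow, div_pow]
            ring
        _ ≤ C * (1 / 2) ^ n := by
            gcongr
            exact hC n
  · intro y hy
    have hy' : |y - x| < ρ / 2 := by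
      have := Metric.mem_ball.mp hy
      rwa [Complex.dist_of_im_eq (by simp), Real.dist_eq] at this
    have hmem : y - x ∈ Metric.eball (0 : ℝ) R := by
      rw [Metric.mem_eball, edist_zero_right]
      refine lt_trans ?_ hρ
      rw [enorm_eq_nnnorm, ENNReal.coe_lt_coe, ← NNReal.coe_lt_coe, coe_nnnorm, Real.norm_eq_abs]
      linarith
    have := (hp.hasSum hmem).tsum_eq
    rw [add_sub_cancel] at this
    rw [← this]
    refine tsum_congr fun n => ?_
    rw [FormalMultilinearSeries.apply_eq_pow_smul_coeff, ← Complex.ofReal_sub,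
      ← Complex.ofReal_pow, Complex.coe_smul]

/-- Two holomorphic functions on discs with real centers which agree with the same function on the
real line agree on the intersection of the discs: if the intersection is not empty, then it
contains a real point, as it is convex and invariant under conjugation. -/
lemma eqOn_inter_ball_of_eqOn_real [CompleteSpace W] {F G : ℂ → W} {a b r t : ℝ}
    (hF : DifferentiableOn ℂ F (Metric.ball (a : ℂ) r))
    (hG : DifferentiableOn ℂ G (Metric.ball (b : ℂ) t))
    (h : ∀ y : ℝ, (y : ℂ) ∈ Metric.ball (a : ℂ) r → (y : ℂ) ∈ Metric.ball (b : ℂ) t → F y = G y) :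
    EqOn F G (Metric.ball (a : ℂ) r ∩ Metric.ball (b : ℂ) t) := by
  intro z hz
  set D := Metric.ball (a : ℂ) r ∩ Metric.ball (b : ℂ) t
  have hD : IsOpen D := Metric.isOpen_ball.inter Metric.isOpen_ball
  have hre : ∀ {c q : ℝ}, z ∈ Metric.ball (c : ℂ) q → (z.re : ℂ) ∈ Metric.ball (c : ℂ) q := by
    intro c q hc
    rw [Metric.mem_ball, dist_eq_norm] at hc ⊢
    rw [← Complex.ofReal_sub, Complex.norm_real]
    refine lt_of_le_of_lt ?_ hc
    simpa using Complex.abs_re_le_norm (z - c)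
  have hmem : (z.re : ℂ) ∈ D := ⟨hre hz.1, hre hz.2⟩
  refine ((hF.mono inter_subset_left).analyticOnNhd hD).eqOn_of_preconnected_of_frequently_eq
    ((hG.mono inter_subset_right).analyticOnNhd hD)
    ((convex_ball _ _).inter (convex_ball _ _)).isPreconnected hmem ?_ hz
  have h1 : Tendsto (fun y : ℝ => (y : ℂ)) (nhdsWithin z.re {z.re}ᶜ)
      (nhdsWithin (z.re : ℂ) {(z.re : ℂ)}ᶜ) := by
    refine tendsto_nhdsWithin_iff.mpr
      ⟨(Complex.continuous_ofReal.tendsto _).mono_left nhdsWithin_le_nhds, ?_⟩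
    filter_upwards [self_mem_nhdsWithin] with y hy
    simpa using hy
  refine h1.frequently (Eventually.frequently ?_)
  have h2 : ∀ᶠ y : ℝ in nhds z.re, (y : ℂ) ∈ D :=
    Complex.continuous_ofReal.continuousAt.preimage_mem_nhds (hD.mem_nhds hmem)
  filter_upwards [nhdsWithin_le_nhds h2] with y hy
  exact h y hy.1 hy.2

/-- A function which is real-analytic at every point of `K` extends holomorphically to a complex
neighborhood of `K`: the discs of convergence can be glued. -/
lemma exists_holomorphic_extension [CompleteSpace W] {g : ℝ → W} {K : Set ℝ}
    (hg : AnalyticOnNhd ℝ g K) :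
    ∃ (U : Set ℂ) (F : ℂ → W), IsOpen U ∧ (∀ x ∈ K, (x : ℂ) ∈ U) ∧
      DifferentiableOn ℂ F U ∧ ∀ x ∈ K, F x = g x := by
  choose! r hr F hF hFg using fun x hx => exists_holomorphic_extension_disc (hg x hx)
  classical
  let G : ℂ → W := fun z => if h : ∃ x ∈ K, z ∈ Metric.ball (x : ℂ) (r x) then F h.choose z else 0
  have hGF : ∀ x ∈ K, EqOn G (F x) (Metric.ball (x : ℂ) (r x)) := by
    intro x hx z hz
    have h : ∃ x ∈ K, z ∈ Metric.ball (x : ℂ) (r x) := ⟨x, hx, hz⟩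
    simp only [G, dif_pos h]
    refine eqOn_inter_ball_of_eqOn_real (hF _ h.choose_spec.1) (hF x hx) (fun y h1 h2 => ?_)
      ⟨h.choose_spec.2, hz⟩
    rw [hFg _ h.choose_spec.1 y h1, hFg x hx y h2]
  refine ⟨⋃ x ∈ K, Metric.ball (x : ℂ) (r x), G,
    isOpen_biUnion fun x _ => Metric.isOpen_ball,
    fun x hx => mem_biUnion hx (Metric.mem_ball_self (hr x hx)), ?_, fun x hx => ?_⟩
  · intro z hz
    obtain ⟨x, hx, hzx⟩ := mem_iUnion₂.mp hz
    have hn := Metric.isOpen_ball.mem_nhds hzx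
    exact (((hF x hx).differentiableAt hn).congr_of_eventuallyEq
      (eventually_of_mem hn (hGF x hx))).differentiableWithinAt
  · rw [hGF x hx (Metric.mem_ball_self (hr x hx)), hFg x hx x (Metric.mem_ball_self (hr x hx))]

end Complexification

/-! ### Elementary estimates -/

lemma norm_mul_log_one_add_le {M : ℝ} {a z : ℂ} (ha : ‖a‖ ≤ M) (hz : ‖z‖ ≤ 1 / 2) :
    ‖a * Complex.log (1 + z)‖ ≤ M := by
  have h1 := Complex.norm_log_one_add_half_le_self hz
  have hM : 0 ≤ M := (norm_nonneg a).trans ha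
  rw [norm_mul]
  calc ‖a‖ * ‖Complex.log (1 + z)‖ ≤ M * 1 := by
        gcongr
        linarith
    _ = M := mul_one M

lemma one_add_ne_zero_of_norm_le {z : ℂ} (hz : ‖z‖ ≤ 1 / 2) : 1 + z ≠ 0 := by
  intro h
  have h1 : z = -1 := by linear_combination h
  rw [h1, norm_neg, norm_one] at hz
  norm_num at hz

lemma norm_one_add_cpow_sub_one_le {M : ℝ} {a z : ℂ} (ha : ‖a‖ ≤ M) (hz : ‖z‖ ≤ 1 / 2) :
    ‖(1 + z) ^ a - 1‖ ≤ 3 / 2 * M * Real.exp M * ‖z‖ := by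
  have h1 := Complex.norm_log_one_add_half_le_self hz
  have h2 := norm_mul_log_one_add_le ha hz
  have h3 := Complex.norm_exp_sub_sum_le_norm_mul_exp (a * Complex.log (1 + z)) 1
  have hM : 0 ≤ M := (norm_nonneg a).trans ha
  rw [Complex.cpow_def_of_ne_zero (one_add_ne_zero_of_norm_le hz), mul_comm (Complex.log _)]
  simp only [Finset.range_one, Finset.sum_singleton, pow_zero, Nat.factorial_zero, Nat.cast_one,
    div_one, pow_one] at h3
  calc _ ≤ _ := h3
    _ ≤ (M * (3 / 2 * ‖z‖)) * Real.exp M := by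
        gcongr
        rw [norm_mul]
        gcongr
    _ = _ := by ring

lemma norm_one_add_cpow_sub_one_sub_le {M : ℝ} {a z : ℂ} (ha : ‖a‖ ≤ M) (hz : ‖z‖ ≤ 1 / 2) :
    ‖(1 + z) ^ a - 1 - a * z‖ ≤ (9 / 4 * M * Real.exp M + 1) * ‖a‖ * ‖z‖ ^ 2 := by
  have h1 := Complex.norm_log_one_add_half_le_self hz
  have h2 := norm_mul_log_one_add_le ha hz
  have h3 := Complex.norm_exp_sub_sum_le_norm_mul_exp (a * Complex.log (1 + z)) 2
  have hM : 0 ≤ M := (norm_nonneg a).trans ha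
  have h4 : ‖Complex.log (1 + z) - z‖ ≤ ‖z‖ ^ 2 := by
    refine (Complex.norm_log_one_add_sub_self_le (by linarith)).trans ?_
    have h5 : (1 - ‖z‖)⁻¹ ≤ 2 := by
      rw [inv_le_comm₀ (by linarith) two_pos]
      linarith
    nlinarith [sq_nonneg ‖z‖]
  rw [Complex.cpow_def_of_ne_zero (one_add_ne_zero_of_norm_le hz), mul_comm (Complex.log _)]
  simp only [Finset.sum_range_succ, Finset.range_zero, Finset.sum_empty, pow_zero,
    Nat.factorial_zero, Nat.cast_one, div_one, pow_one, zero_add, Nat.factorial_one] at h3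
  set u := a * Complex.log (1 + z) with hu
  have hun : ‖u‖ ≤ ‖a‖ * (3 / 2 * ‖z‖) := by
    rw [hu, norm_mul]
    gcongr
  calc ‖Complex.exp u - 1 - a * z‖
      = ‖(Complex.exp u - (1 + u)) + a * (Complex.log (1 + z) - z)‖ := by
        congr 1
        rw [hu]
        ring
    _ ≤ ‖Complex.exp u - (1 + u)‖ + ‖a * (Complex.log (1 + z) - z)‖ := norm_add_le _ _
    _ ≤ ‖u‖ ^ 2 * Real.exp ‖u‖ + ‖a‖ * ‖z‖ ^ 2 := by
        rw [norm_mul]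
        gcongr
    _ ≤ (‖a‖ * (3 / 2 * ‖z‖)) ^ 2 * Real.exp M + ‖a‖ * ‖z‖ ^ 2 := by gcongr
    _ = ‖a‖ * (9 / 4 * ‖a‖ * Real.exp M + 1) * ‖z‖ ^ 2 := by ring
    _ ≤ ‖a‖ * (9 / 4 * M * Real.exp M + 1) * ‖z‖ ^ 2 := by gcongr
    _ = _ := by ring

lemma add_cpow_eq_mul_one_add_cpow {y : ℂ} (hy : 0 < y.re) {ℓ : ℝ} (hℓ : 0 < ℓ) (a : ℂ) :
    (y + ℓ) ^ a = y ^ a * (1 + ℓ / y) ^ a := by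
  have hy0 : y ≠ 0 := by
    rintro rfl
    simp at hy
  have hre : 0 < (1 + ℓ / y : ℂ).re := by
    have : 0 < Complex.normSq y := Complex.normSq_pos.mpr hy0
    rw [Complex.add_re, Complex.one_re, Complex.div_re, Complex.ofReal_re, Complex.ofReal_im]
    simp only [zero_mul, zero_div, add_zero]
    positivity
  have h0 : (1 + ℓ / y : ℂ) ≠ 0 := by
    intro h
    rw [h] at hre
    simp at hre
  have e : y + ℓ = y * (1 + ℓ / y) := by field_simp
  have h1 : |y.arg| < Real.pi / 2 := Complex.abs_arg_lt_pi_div_two_iff.mpr (Or.inl hy)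
  have h2 : |(1 + ℓ / y : ℂ).arg| < Real.pi / 2 :=
    Complex.abs_arg_lt_pi_div_two_iff.mpr (Or.inl hre)
  rw [abs_lt] at h1 h2
  rw [e, Complex.cpow_def_of_ne_zero (mul_ne_zero hy0 h0), Complex.cpow_def_of_ne_zero hy0,
    Complex.cpow_def_of_ne_zero h0,
    Complex.log_mul hy0 h0 ⟨by linarith [h1.1, h2.1], by linarith [h1.2, h2.2]⟩, add_mul,
    Complex.exp_add]

lemma norm_cpow_le_of_norm_le (y : ℂ) {a : ℂ} {M : ℝ} (ha : ‖a‖ ≤ M) :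
    ‖y ^ a‖ ≤ ‖y‖ ^ a.re * Real.exp (Real.pi * M) := by
  refine (Complex.norm_cpow_le y a).trans ?_
  rw [div_eq_mul_inv, ← Real.exp_neg]
  gcongr
  calc -(y.arg * a.im) ≤ |y.arg * a.im| := neg_le_abs _
    _ = |y.arg| * |a.im| := abs_mul _ _
    _ ≤ Real.pi * M := by
        gcongr
        · exact Complex.abs_arg_le_pi y
        · exact (Complex.abs_im_le_norm a).trans ha

/-- The convexity of `b ↦ b ^ (-p)`. -/
lemma rpow_neg_sub_one_mul_le {b ℓ p : ℝ} (hb : 0 < b) (hℓ : 0 < ℓ) (hp : 0 < p) :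
    (b + ℓ) ^ (-p - 1) * (p * ℓ) ≤ b ^ (-p) - (b + ℓ) ^ (-p) := by
  have hbl : 0 < b + ℓ := by linarith
  have h1 : 1 + p * (ℓ / (b + ℓ)) ≤ ((b + ℓ) / b) ^ p := by
    have hlog : ℓ / (b + ℓ) ≤ Real.log ((b + ℓ) / b) := by
      have := Real.one_sub_inv_le_log_of_pos (div_pos hbl hb)
      refine le_trans (le_of_eq ?_) this
      field_simp
      ring
    rw [Real.rpow_def_of_pos (div_pos hbl hb)]
    calc 1 + p * (ℓ / (b + ℓ)) ≤ Real.log ((b + ℓ) / b) * p + 1 := by nlinarith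
      _ ≤ _ := Real.add_one_le_exp _
  have h2 : b ^ (-p) = (b + ℓ) ^ (-p) * ((b + ℓ) / b) ^ p := by
    rw [Real.div_rpow hbl.le hb.le, Real.rpow_neg hb.le, Real.rpow_neg hbl.le]
    have := Real.rpow_pos_of_pos hbl p
    field_simp
  have h3 : (b + ℓ) ^ (-p - 1) * (p * ℓ) = (b + ℓ) ^ (-p) * (p * (ℓ / (b + ℓ))) := by
    rw [Real.rpow_sub hbl, Real.rpow_one]
    ring
  rw [h2, h3]
  nlinarith [Real.rpow_pos_of_pos hbl (-p)]

lemma sum_range_rpow_le {b ℓ p : ℝ} (hb : 0 < b) (hℓ : 0 < ℓ) (hp : 0 < p) (N : ℕ) :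
    ∑ n ∈ Finset.range N, (b + (n + 1) * ℓ) ^ (-p - 1) ≤ b ^ (-p) / (p * ℓ) := by
  have hpl : 0 < p * ℓ := by positivity
  have key : ∑ n ∈ Finset.range N, (b + (n + 1) * ℓ) ^ (-p - 1) * (p * ℓ) ≤
      b ^ (-p) - (b + N * ℓ) ^ (-p) := by
    induction N with
    | zero => simp
    | succ N ih =>
      rw [Finset.sum_range_succ]
      have := rpow_neg_sub_one_mul_le (b := b + N * ℓ) (by positivity) hℓ hp
      rw [show b + N * ℓ + ℓ = b + (N + 1) * ℓ by ring] at this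
      push_cast
      linarith
  rw [le_div_iff₀ hpl, Finset.sum_mul]
  have : 0 ≤ (b + N * ℓ) ^ (-p) := by positivity
  linarith

lemma summable_rpow {b ℓ p : ℝ} (hb : 0 < b) (hℓ : 0 < ℓ) (hp : 0 < p) :
    Summable fun n : ℕ => (b + (n + 1) * ℓ) ^ (-p - 1) :=
  summable_of_sum_range_le (fun n => by positivity) (sum_range_rpow_le hb hℓ hp)

lemma tsum_rpow_le {b ℓ p : ℝ} (hb : 0 < b) (hℓ : 0 < ℓ) (hp : 0 < p) :
    ∑' n : ℕ, (b + (n + 1) * ℓ) ^ (-p - 1) ≤ b ^ (-p) / (p * ℓ) :=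
  Real.tsum_le_of_sum_range_le (fun n => by positivity) (sum_range_rpow_le hb hℓ hp)

section Hurwitz

variable {V : Type*} [NormedAddCommGroup V] [InnerProductSpace ℂ V]

/-! ### The Hurwitz-type series `∑ Uⁿ (x + n ℓ) ^ (-2 t) h(1 / (x + n ℓ))` -/

lemma norm_isometry_pow_apply (U : V ≃ₗᵢ[ℂ] V) (n : ℕ) (v : V) : ‖(U ^ n) v‖ = ‖v‖ :=
  (U ^ n).norm_map v

/-- For a unitary operator `U` the space is the sum of `ker (U - 1)` and the range of `U - 1`. -/
lemma exists_eq_add_map_sub [FiniteDimensional ℂ V] (U : V ≃ₗᵢ[ℂ] V) (v : V) :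
    ∃ p q : V, U p = p ∧ v = p + U q - q := by
  let A : V →ₗ[ℂ] V := (U.toLinearEquiv : V →ₗ[ℂ] V) - LinearMap.id
  have hdisj : Disjoint (LinearMap.ker A) (LinearMap.range A) := by
    rw [Submodule.disjoint_def]
    rintro x hx ⟨w, rfl⟩
    have hx' : U (A w) = A w := by
      have : U (A w) - A w = 0 := hx
      exact sub_eq_zero.mp this
    have h : inner ℂ (A w) (A w) = (0 : ℂ) := by
      have e : A w = U w - w := rfl
      nth_rewrite 2 [e]
      rw [inner_sub_right]
      nth_rewrite 1 [← hx']
      rw [U.inner_map_map, sub_self]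
    exact inner_self_eq_zero.mp h
  have htop := Submodule.eq_top_of_disjoint _ _
    (by rw [add_comm, LinearMap.finrank_range_add_finrank_ker]) hdisj
  obtain ⟨p, hp, r, ⟨q, rfl⟩, h⟩ := Submodule.mem_sup.mp (htop ▸ Submodule.mem_top : v ∈ _)
  refine ⟨p, q, sub_eq_zero.mp hp, ?_⟩
  rw [← h, add_sub_assoc]
  rfl

/-- An approximate solution `D` of the difference equation
`U D(y + ℓ) - D(y) = y ^ (-2 t) (p + U q - q)`, where `U p = p`. -/
def approxPrim (ℓ : ℝ) (p q : V) (t y : ℂ) : V :=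
  (y ^ (1 - 2 * t) / (ℓ * (1 - 2 * t))) • p + y ^ (-2 * t) • q

/-- The error of `approxPrim` as a solution of the difference equation with right-hand side
`y ^ (-2 t) h(1 / y)`. -/
def approxErr (ℓ : ℝ) (U : V ≃ₗᵢ[ℂ] V) (h : ℂ → V) (p q : V) (t y : ℂ) : V :=
  y ^ (-2 * t) • h (1 / y) - U (approxPrim ℓ p q t (y + ℓ)) + approxPrim ℓ p q t y

lemma approxErr_eq {ℓ : ℝ} (hℓ : 0 < ℓ) {U : V ≃ₗᵢ[ℂ] V} {h : ℂ → V} {p q : V} (hp : U p = p)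
    (hpq : h 0 = p + U q - q) {t y : ℂ} (ht : t ≠ 1 / 2) (hy : 0 < y.re) :
    approxErr ℓ U h p q t y = y ^ (-2 * t) • (h (1 / y) - h 0 -
      (((1 + ℓ / y) ^ (1 - 2 * t) - 1 - (1 - 2 * t) * (ℓ / y)) * (y / (ℓ * (1 - 2 * t)))) • p -
      ((1 + ℓ / y) ^ (-2 * t) - 1) • U q) := by
  have hy0 : y ≠ 0 := by
    rintro rfl
    simp at hy
  have hl : (ℓ : ℂ) ≠ 0 := by exact_mod_cast hℓ.ne'
  have hc : 1 - 2 * t ≠ 0 := by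
    intro h0
    apply ht
    linear_combination -h0 / 2
  have e1 : y ^ (1 - 2 * t) = y * y ^ (-2 * t) := by
    rw [sub_eq_add_neg, Complex.cpow_add _ _ hy0, Complex.cpow_one, neg_mul]
  rw [approxErr, approxPrim, approxPrim, add_cpow_eq_mul_one_add_cpow hy hℓ,
    add_cpow_eq_mul_one_add_cpow hy hℓ, map_add, map_smul, map_smul, hp, e1, hpq]
  set A := (1 + ℓ / y) ^ (1 - 2 * t)
  set B := (1 + ℓ / y) ^ (-2 * t)
  set E := y ^ (-2 * t)
  have e2 : (A - 1 - (1 - 2 * t) * (ℓ / y)) * (y / (ℓ * (1 - 2 * t))) =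
      y * A / (ℓ * (1 - 2 * t)) - y / (ℓ * (1 - 2 * t)) - 1 := by
    field_simp
  rw [e2]
  have e3 : y * E * A / (ℓ * (1 - 2 * t)) = E * (y * A / (ℓ * (1 - 2 * t))) := by ring
  have e4 : y * E / (ℓ * (1 - 2 * t)) = E * (y / (ℓ * (1 - 2 * t))) := by ring
  rw [e3, e4]
  module

/-- The error is `O(|y| ^ (-2 Re t - 1))`, locally uniformly in `t`. -/
lemma norm_approxErr_le {ℓ : ℝ} (hℓ : 0 < ℓ) {U : V ≃ₗᵢ[ℂ] V} {h : ℂ → V} {p q : V}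
    (hp : U p = p) (hpq : h 0 = p + U q - q) {L X : ℝ} (hX : 2 * ℓ ≤ X) (hX1 : 1 ≤ X)
    (hL : ∀ w, ‖w‖ ≤ 1 / X → ‖h w - h 0‖ ≤ L * ‖w‖) (M : ℝ) :
    ∃ K, 0 ≤ K ∧ ∀ t : ℂ, ‖t‖ ≤ M → t ≠ 1 / 2 → ∀ σ : ℝ, 0 < σ → σ ≤ t.re → ∀ y : ℂ, X ≤ y.re →
      ‖approxErr ℓ U h p q t y‖ ≤ K * y.re ^ (-(2 * σ) - 1) := by
  set M' := 1 + 2 * M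
  set C := 9 / 4 * M' * Real.exp M' + 1
  set C' := 3 / 2 * M' * Real.exp M'
  set K := Real.exp (Real.pi * M') * (|L| + C * ℓ * ‖p‖ + C' * ℓ * ‖q‖)
  by_cases hM : 0 ≤ M
  swap
  · exact ⟨0, le_rfl, fun t ht => absurd ((norm_nonneg t).trans ht) hM⟩
  refine ⟨K, by positivity, fun t ht ht' σ hσ hσt y hy => ?_⟩
  have hX0 : 0 < X := by linarith
  have hyre : 0 < y.re := by linarith
  have hn : y.re ≤ ‖y‖ := Complex.re_le_norm y
  have hy0 : 0 < ‖y‖ := by linarith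
  have h1y : ‖1 / y‖ = 1 / ‖y‖ := by rw [norm_div, norm_one]
  have hly : ‖(ℓ / y : ℂ)‖ = ℓ / ‖y‖ := by
    rw [norm_div, Complex.norm_real, Real.norm_of_nonneg hℓ.le]
  have hz : ‖(ℓ / y : ℂ)‖ ≤ 1 / 2 := by
    rw [hly, div_le_iff₀ hy0]
    linarith
  have ha1 : ‖1 - 2 * t‖ ≤ M' := by
    refine (norm_sub_le _ _).trans ?_
    rw [norm_mul]
    simp only [norm_one, Complex.norm_ofNat, M']
    linarith
  have ha2 : ‖-2 * t‖ ≤ M' := by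
    rw [norm_mul, norm_neg]
    simp only [Complex.norm_ofNat, M']
    linarith
  have hc : 1 - 2 * t ≠ 0 := by
    intro h0
    apply ht'
    linear_combination -h0 / 2
  have hc' : 0 < ‖1 - 2 * t‖ := norm_pos_iff.mpr hc
  have b1 : ‖h (1 / y) - h 0‖ ≤ |L| * (1 / ‖y‖) := by
    rw [← h1y]
    refine (hL _ ?_).trans (by gcongr; exact le_abs_self L)
    rw [h1y]
    exact one_div_le_one_div_of_le hX0 (hy.trans hn)
  have b2 : ‖(((1 + ℓ / y) ^ (1 - 2 * t) - 1 - (1 - 2 * t) * (ℓ / y)) *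
      (y / (ℓ * (1 - 2 * t)))) • p‖ ≤ C * ℓ * ‖p‖ * (1 / ‖y‖) := by
    rw [norm_smul, norm_mul, norm_div, norm_mul, Complex.norm_real, Real.norm_of_nonneg hℓ.le]
    calc _ ≤ (C * ‖1 - 2 * t‖ * ‖(ℓ / y : ℂ)‖ ^ 2) * (‖y‖ / (ℓ * ‖1 - 2 * t‖)) * ‖p‖ := by
          gcongr
          exact norm_one_add_cpow_sub_one_sub_le ha1 hz
      _ = C * ℓ * ‖p‖ * (1 / ‖y‖) := by
          rw [hly]
          field_simp
  have b3 : ‖((1 + ℓ / y) ^ (-2 * t) - 1) • U q‖ ≤ C' * ℓ * ‖q‖ * (1 / ‖y‖) := by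
    rw [norm_smul, U.norm_map]
    calc _ ≤ (C' * ‖(ℓ / y : ℂ)‖) * ‖q‖ := by
          gcongr
          exact norm_one_add_cpow_sub_one_le ha2 hz
      _ = _ := by
          rw [hly]
          ring
  have b4 : ‖y ^ (-2 * t)‖ ≤ y.re ^ (-(2 * σ)) * Real.exp (Real.pi * M') := by
    refine (norm_cpow_le_of_norm_le y ha2).trans ?_
    gcongr
    have e : (-2 * t).re = -(2 * t.re) := by simp
    rw [e]
    calc ‖y‖ ^ (-(2 * t.re)) ≤ y.re ^ (-(2 * t.re)) :=
          Real.rpow_le_rpow_of_nonpos hyre hn (by linarith)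
      _ ≤ y.re ^ (-(2 * σ)) := Real.rpow_le_rpow_of_exponent_le (by linarith) (by linarith)
  rw [approxErr_eq hℓ hp hpq ht' hyre, norm_smul]
  calc _ ≤ (y.re ^ (-(2 * σ)) * Real.exp (Real.pi * M')) *
        (|L| * (1 / ‖y‖) + C * ℓ * ‖p‖ * (1 / ‖y‖) + C' * ℓ * ‖q‖ * (1 / ‖y‖)) := by
        gcongr
        exact (norm_sub_le _ _).trans
          (add_le_add ((norm_sub_le _ _).trans (add_le_add b1 b2)) b3)
    _ = y.re ^ (-(2 * σ)) * K * (1 / ‖y‖) := by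
        simp only [K]
        ring
    _ ≤ y.re ^ (-(2 * σ)) * K * (1 / y.re) := by gcongr
    _ = K * y.re ^ (-(2 * σ) - 1) := by
        rw [Real.rpow_sub hyre, Real.rpow_one]
        ring

/-- The analytic continuation in `t` of `∑_{n ≥ 1} Uⁿ (x + n ℓ) ^ (-2 t) h(1 / (x + n ℓ))`, for `x`
of large real part. It is obtained by summing the difference equation of `approxPrim`, the series
of the errors being absolutely convergent for `Re t > 0`. -/
def hurwitzCont (ℓ : ℝ) (U : V ≃ₗᵢ[ℂ] V) (h : ℂ → V) (p q : V) (t x : ℂ) : V :=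
  -(U (approxPrim ℓ p q t (x + ℓ))) +
    ∑' n : ℕ, (U ^ (n + 1)) (approxErr ℓ U h p q t (x + ((n : ℂ) + 1) * ℓ))

/-- The hypotheses under which `hurwitzCont ℓ U h p q t x` is studied for `Re x ≥ X`. -/
structure HurwitzData (ℓ : ℝ) (U : V ≃ₗᵢ[ℂ] V) (h : ℂ → V) (p q : V) (X : ℝ) : Prop where
  ℓ_pos : 0 < ℓ
  map_p : U p = p
  decomp : h 0 = p + U q - q
  two_mul_le : 2 * ℓ ≤ X
  one_le : 1 ≤ X
  differentiableAt : ∀ w : ℂ, ‖w‖ ≤ 1 / X → DifferentiableAt ℂ h w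
  bound : ∃ L, ∀ w, ‖w‖ ≤ 1 / X → ‖h w - h 0‖ ≤ L * ‖w‖

lemma exists_hurwitzData [FiniteDimensional ℂ V] {ℓ : ℝ} (hℓ : 0 < ℓ) (U : V ≃ₗᵢ[ℂ] V) {h : ℂ → V}
    {O : Set ℂ} (hO : IsOpen O) (h0 : (0 : ℂ) ∈ O) (hh : DifferentiableOn ℂ h O) :
    ∃ p q X, HurwitzData ℓ U h p q X := by
  obtain ⟨p, q, hp, hpq⟩ := exists_eq_add_map_sub U (h 0)
  obtain ⟨L, hL⟩ := (hh.differentiableAt (hO.mem_nhds h0)).isBigO_sub.bound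
  obtain ⟨r, hr, hrO⟩ := Metric.eventually_nhds_iff_ball.mp (hL.and (hO.mem_nhds h0))
  have hb : ∀ w : ℂ, ‖w‖ ≤ 1 / max (max 1 (2 * ℓ)) (2 / r) → w ∈ Metric.ball (0 : ℂ) r := by
    intro w hw
    rw [mem_ball_zero_iff]
    refine lt_of_le_of_lt (hw.trans (one_div_le_one_div_of_le (by positivity)
      (le_max_right _ _))) ?_
    rw [one_div_div]
    linarith
  refine ⟨p, q, max (max 1 (2 * ℓ)) (2 / r), hℓ, hp, hpq,
    (le_max_right _ _).trans (le_max_left _ _), (le_max_left _ _).trans (le_max_left _ _),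
    fun w hw => hh.differentiableAt (hO.mem_nhds (hrO w (hb w hw)).2), L, fun w hw => ?_⟩
  simpa using (hrO w (hb w hw)).1

namespace HurwitzData

variable {ℓ : ℝ} {U : V ≃ₗᵢ[ℂ] V} {h : ℂ → V} {p q : V} {X : ℝ}

lemma X_pos (H : HurwitzData ℓ U h p q X) : 0 < X := by linarith [H.one_le]

lemma differentiableAt_approxPrim (H : HurwitzData ℓ U h p q X) {τ η : ℂ → ℂ} {z : ℂ}
    (hτ : DifferentiableAt ℂ τ z) (hη : DifferentiableAt ℂ η z) (hz : τ z ≠ 1 / 2)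
    (hz' : X ≤ (η z).re) : DifferentiableAt ℂ (fun z => approxPrim ℓ p q (τ z) (η z)) z := by
  have hc : (ℓ : ℂ) * (1 - 2 * τ z) ≠ 0 := by
    refine mul_ne_zero (by exact_mod_cast H.ℓ_pos.ne') fun h => hz ?_
    linear_combination -h / 2
  have hs : η z ∈ Complex.slitPlane := Or.inl (H.X_pos.trans_le hz')
  unfold approxPrim
  exact DifferentiableAt.add (DifferentiableAt.smul_const (DifferentiableAt.div
    (hη.cpow (by fun_prop) hs) (by fun_prop) hc) p)
    (DifferentiableAt.smul_const (hη.cpow (by fun_prop) hs) q)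

lemma differentiableAt_map_approxPrim (H : HurwitzData ℓ U h p q X) {τ η : ℂ → ℂ} {z : ℂ}
    (hτ : DifferentiableAt ℂ τ z) (hη : DifferentiableAt ℂ η z) (hz : τ z ≠ 1 / 2)
    (hz' : X ≤ (η z).re) :
    DifferentiableAt ℂ (fun z => U (approxPrim ℓ p q (τ z) (η z + ℓ))) z := by
  refine U.differentiable.differentiableAt.comp z
    (H.differentiableAt_approxPrim hτ (hη.add_const _) hz ?_)
  simp only [Complex.add_re, Complex.ofReal_re]
  linarith [H.ℓ_pos]

lemma differentiableAt_approxErr (H : HurwitzData ℓ U h p q X) {τ η : ℂ → ℂ} {z : ℂ}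
    (hτ : DifferentiableAt ℂ τ z) (hη : DifferentiableAt ℂ η z) (hz : τ z ≠ 1 / 2)
    (hz' : X ≤ (η z).re) : DifferentiableAt ℂ (fun z => approxErr ℓ U h p q (τ z) (η z)) z := by
  have hre : 0 < (η z).re := H.X_pos.trans_le hz'
  have h0 : η z ≠ 0 := by
    intro h
    rw [h] at hre
    simp at hre
  have hw : ‖1 / η z‖ ≤ 1 / X := by
    rw [norm_div, norm_one]
    exact one_div_le_one_div_of_le H.X_pos (hz'.trans (Complex.re_le_norm _))
  unfold approxErr
  exact DifferentiableAt.add (DifferentiableAt.sub (DifferentiableAt.smul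
    (hη.cpow (by fun_prop) (Or.inl hre))
    (DifferentiableAt.comp z (g := h) (f := fun z => 1 / η z) (H.differentiableAt _ hw)
      (DifferentiableAt.div (by fun_prop) hη h0)))
    (H.differentiableAt_map_approxPrim hτ hη hz hz')) (H.differentiableAt_approxPrim hτ hη hz hz')

/-- The bound of the terms of the series in `hurwitzCont`. -/
lemma norm_term_le (H : HurwitzData ℓ U h p q X) (M : ℝ) :
    ∃ K, 0 ≤ K ∧ ∀ t : ℂ, ‖t‖ ≤ M → t ≠ 1 / 2 → ∀ σ : ℝ, 0 < σ → σ ≤ t.re → ∀ b, X ≤ b →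
      ∀ x : ℂ, b ≤ x.re → ∀ n : ℕ,
      ‖(U ^ (n + 1)) (approxErr ℓ U h p q t (x + ((n : ℂ) + 1) * ℓ))‖ ≤
        K * (b + (n + 1) * ℓ) ^ (-(2 * σ) - 1) := by
  obtain ⟨L, hL⟩ := H.bound
  obtain ⟨K, hK, hK'⟩ := norm_approxErr_le H.ℓ_pos H.map_p H.decomp H.two_mul_le H.one_le hL M
  refine ⟨K, hK, fun t ht ht' σ hσ hσt b hb x hx n => ?_⟩
  have hℓ := H.ℓ_pos
  have hXpos := H.X_pos
  have e : (x + ((n : ℂ) + 1) * ℓ).re = x.re + (n + 1) * ℓ := by simp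
  have hn : 0 ≤ ((n : ℝ) + 1) * ℓ := by positivity
  rw [norm_isometry_pow_apply]
  refine (hK' t ht ht' σ hσ hσt _ (by rw [e]; linarith)).trans ?_
  rw [e]
  have : (x.re + (n + 1) * ℓ) ^ (-(2 * σ) - 1) ≤ (b + (n + 1) * ℓ) ^ (-(2 * σ) - 1) :=
    Real.rpow_le_rpow_of_nonpos (by linarith) (by linarith) (by linarith)
  gcongr

lemma differentiableAt_term (H : HurwitzData ℓ U h p q X) {τ η : ℂ → ℂ} {z : ℂ}
    (hτ : DifferentiableAt ℂ τ z) (hη : DifferentiableAt ℂ η z) (hz : τ z ≠ 1 / 2)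
    (hz' : X ≤ (η z).re) (n : ℕ) :
    DifferentiableAt ℂ (fun z => (U ^ (n + 1))
      (approxErr ℓ U h p q (τ z) (η z + ((n : ℂ) + 1) * ℓ))) z := by
  refine (U ^ (n + 1)).differentiable.differentiableAt.comp z
    (H.differentiableAt_approxErr hτ (hη.add_const _) hz ?_)
  have hℓ := H.ℓ_pos
  have hn : 0 ≤ ((n : ℝ) + 1) * ℓ := by positivity
  have e : (η z + ((n : ℂ) + 1) * ℓ).re = (η z).re + (n + 1) * ℓ := by simp
  rw [e]
  linarith

lemma differentiableOn_param [FiniteDimensional ℂ V] (H : HurwitzData ℓ U h p q X) {x : ℝ}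
    (hx : X ≤ x) : DifferentiableOn ℂ (fun t => hurwitzCont ℓ U h p q t x) contDomain := by
  have : CompleteSpace V := FiniteDimensional.complete ℂ V
  rintro t₀ ⟨ht₀, ht₀'⟩
  obtain ⟨K, -, hK⟩ := H.norm_term_le (‖t₀‖ + 1)
  let O : Set ℂ := {t | t₀.re / 2 < t.re} ∩ {t | t ≠ 1 / 2} ∩ {t | ‖t‖ < ‖t₀‖ + 1}
  have hO : IsOpen O := ((isOpen_lt continuous_const Complex.continuous_re).inter isOpen_ne).inter
    (isOpen_lt continuous_norm continuous_const)
  have hmem : t₀ ∈ O := ⟨⟨show t₀.re / 2 < t₀.re by linarith, ht₀'⟩,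
    show ‖t₀‖ < ‖t₀‖ + 1 by linarith⟩
  have hx' : X ≤ ((x : ℂ)).re := by simpa using hx
  refine DifferentiableAt.differentiableWithinAt (DifferentiableAt.add
    (H.differentiableAt_map_approxPrim differentiableAt_id (differentiableAt_const _) ht₀' hx').neg
    ?_)
  refine DifferentiableOn.differentiableAt (s := O) ?_ (hO.mem_nhds hmem)
  refine Complex.differentiableOn_tsum_of_summable_norm
    (u := fun n : ℕ => K * (X + (n + 1) * ℓ) ^ (-(2 * (t₀.re / 2)) - 1))
    ((summable_rpow H.X_pos H.ℓ_pos (by linarith)).mul_left K) (fun n t ht => ?_) hO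
    (fun n t ht => ?_)
  · exact (H.differentiableAt_term differentiableAt_id (differentiableAt_const _)
      ht.1.2 hx' n).differentiableWithinAt
  · exact hK t (le_of_lt ht.2) ht.1.2 _ (by linarith) (le_of_lt ht.1.1) X le_rfl x hx' n

lemma differentiableOn_point [FiniteDimensional ℂ V] (H : HurwitzData ℓ U h p q X) {s : ℂ}
    (hs : 0 < s.re) (hs' : s ≠ 1 / 2) :
    DifferentiableOn ℂ (fun x => hurwitzCont ℓ U h p q s x) {x | X < x.re} := by
  have : CompleteSpace V := FiniteDimensional.complete ℂ V
  obtain ⟨K, -, hK⟩ := H.norm_term_le ‖s‖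
  refine DifferentiableOn.add (fun x hx => (H.differentiableAt_map_approxPrim
    (differentiableAt_const _) differentiableAt_id hs' (le_of_lt hx)).neg.differentiableWithinAt) ?_
  refine Complex.differentiableOn_tsum_of_summable_norm
    (u := fun n : ℕ => K * (X + (n + 1) * ℓ) ^ (-(2 * s.re) - 1))
    ((summable_rpow H.X_pos H.ℓ_pos (by linarith)).mul_left K) (fun n x hx => ?_)
    (isOpen_lt continuous_const Complex.continuous_re) (fun n x hx => ?_)
  · exact (H.differentiableAt_term (differentiableAt_const _) differentiableAt_id
      hs' (le_of_lt hx) n).differentiableWithinAt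
  · exact hK s le_rfl hs' _ hs le_rfl X le_rfl x (le_of_lt hx) n

lemma summable_term [FiniteDimensional ℂ V] (H : HurwitzData ℓ U h p q X) {t : ℂ}
    (ht : 0 < t.re) (ht' : t ≠ 1 / 2) {x : ℝ} (hx : X ≤ x) :
    Summable fun n : ℕ => (U ^ (n + 1)) (approxErr ℓ U h p q t (x + ((n : ℂ) + 1) * ℓ)) := by
  have : CompleteSpace V := FiniteDimensional.complete ℂ V
  obtain ⟨K, -, hK⟩ := H.norm_term_le ‖t‖
  exact Summable.of_norm_bounded
    ((summable_rpow (H.X_pos.trans_le hx) H.ℓ_pos (by linarith : 0 < 2 * t.re)).mul_left K)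
    fun n => hK t le_rfl ht' _ ht le_rfl x hx x (by simp) n

lemma sum_range_eq (ℓ : ℝ) (U : V ≃ₗᵢ[ℂ] V) (h : ℂ → V) (p q : V) (t x : ℂ) (N : ℕ) :
    ∑ n ∈ Finset.range N, (U ^ (n + 1))
        ((x + ((n : ℂ) + 1) * ℓ) ^ (-2 * t) • h (1 / (x + ((n : ℂ) + 1) * ℓ))) =
      (U ^ (N + 1)) (approxPrim ℓ p q t (x + ((N : ℂ) + 1) * ℓ)) -
        U (approxPrim ℓ p q t (x + ℓ)) +
        ∑ n ∈ Finset.range N, (U ^ (n + 1)) (approxErr ℓ U h p q t (x + ((n : ℂ) + 1) * ℓ)) := by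
  induction N with
  | zero => simp
  | succ N ih =>
    rw [Finset.sum_range_succ, Finset.sum_range_succ, ih, approxErr, pow_succ U (N + 1),
      LinearIsometryEquiv.coe_mul, Function.comp_apply, map_add, map_sub]
    rw [show x + ((N : ℂ) + 1) * ℓ + ℓ = x + (((N + 1 : ℕ) : ℂ) + 1) * ℓ by push_cast; ring]
    abel

lemma hasSum [FiniteDimensional ℂ V] (H : HurwitzData ℓ U h p q X) {t : ℂ} (ht : 1 / 2 < t.re)
    {x : ℝ} (hx : X ≤ x) :
    HasSum (fun n : ℕ => (U ^ (n + 1))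
      (((x : ℂ) + ((n : ℂ) + 1) * ℓ) ^ (-2 * t) • h (1 / (x + ((n : ℂ) + 1) * ℓ))))
      (hurwitzCont ℓ U h p q t x) := by
  have : CompleteSpace V := FiniteDimensional.complete ℂ V
  have hℓ := H.ℓ_pos
  have hx0 : 0 < x := H.X_pos.trans_le hx
  have ht' : t ≠ 1 / 2 := by
    rintro rfl
    norm_num at ht
  have hcast : ∀ n : ℕ, (x : ℂ) + ((n : ℂ) + 1) * ℓ = ((x + (n + 1) * ℓ : ℝ) : ℂ) := by
    intro n
    push_cast
    ring
  have hpos : ∀ n : ℕ, 0 < x + (n + 1) * ℓ := fun n => by positivity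
  have hge : ∀ n : ℕ, X ≤ x + (n + 1) * ℓ := fun n => by
    have : 0 ≤ ((n : ℝ) + 1) * ℓ := by positivity
    linarith
  have hnorm : ∀ (n : ℕ) (a : ℂ), ‖((x : ℂ) + ((n : ℂ) + 1) * ℓ) ^ a‖ = (x + (n + 1) * ℓ) ^ a.re :=
    fun n a => by rw [hcast, Complex.norm_cpow_eq_rpow_re_of_pos (hpos n)]
  have hsum : Summable fun n : ℕ => (U ^ (n + 1))
      (((x : ℂ) + ((n : ℂ) + 1) * ℓ) ^ (-2 * t) • h (1 / (x + ((n : ℂ) + 1) * ℓ))) := by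
    obtain ⟨L, hL⟩ := H.bound
    refine Summable.of_norm_bounded ((summable_rpow hx0 hℓ
      (by linarith : 0 < 2 * t.re - 1)).mul_right (‖h 0‖ + |L| * (1 / X))) fun n => ?_
    rw [norm_isometry_pow_apply, norm_smul, hnorm]
    have e : (-2 * t).re = -(2 * t.re - 1) - 1 := by
      simp
    rw [e]
    have hw : ‖1 / ((x : ℂ) + ((n : ℂ) + 1) * ℓ)‖ ≤ 1 / X := by
      rw [hcast, norm_div, norm_one, Complex.norm_real, Real.norm_of_nonneg (hpos n).le]
      exact one_div_le_one_div_of_le H.X_pos (hge n)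
    have := hpos n
    gcongr
    calc ‖h (1 / ((x : ℂ) + ((n : ℂ) + 1) * ℓ))‖
        ≤ ‖h 0‖ + ‖h (1 / ((x : ℂ) + ((n : ℂ) + 1) * ℓ)) - h 0‖ := norm_le_norm_add_norm_sub' _ _
      _ ≤ ‖h 0‖ + |L| * (1 / X) := by
        gcongr
        refine (hL _ hw).trans ?_
        gcongr
        exact le_abs_self L
  rw [hsum.hasSum_iff_tendsto_nat]
  simp_rw [sum_range_eq ℓ U h p q t x]
  have hD : Tendsto (fun N : ℕ => (U ^ (N + 1)) (approxPrim ℓ p q t (x + ((N : ℂ) + 1) * ℓ)))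
      atTop (nhds 0) := by
    have hlin : Tendsto (fun N : ℕ => x + ((N : ℝ) + 1) * ℓ) atTop atTop :=
      tendsto_atTop_add_const_left _ _ (Tendsto.atTop_mul_const hℓ
        (tendsto_atTop_add_const_right _ _ tendsto_natCast_atTop_atTop))
    have hz : ∀ a : ℂ, a.re < 0 →
        Tendsto (fun N : ℕ => ((x : ℂ) + ((N : ℂ) + 1) * ℓ) ^ a) atTop (nhds 0) := by
      intro a ha
      rw [tendsto_zero_iff_norm_tendsto_zero]
      simp_rw [hnorm]
      have := (tendsto_rpow_neg_atTop (y := -a.re) (by linarith)).comp hlin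
      simpa [Function.comp_def] using this
    rw [tendsto_zero_iff_norm_tendsto_zero]
    simp_rw [norm_isometry_pow_apply]
    rw [← tendsto_zero_iff_norm_tendsto_zero]
    have h1 := ((hz (1 - 2 * t) (by simp; linarith)).div_const
      ((ℓ : ℂ) * (1 - 2 * t))).smul_const p
    have h2 := (hz (-2 * t) (by simp; linarith)).smul_const q
    simpa [approxPrim] using h1.add h2
  have hE := (H.summable_term (by linarith) ht' hx).hasSum.tendsto_sum_nat
  have := (hD.sub_const (U (approxPrim ℓ p q t (x + ℓ)))).add hE
  rwa [zero_sub] at this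

/-- The leading term comes from `approxPrim`; everything else is `O(x ^ (-2 s))`. -/
lemma isBigO [FiniteDimensional ℂ V] (H : HurwitzData ℓ U h p q X) {s : ℂ} (hs : 0 < s.re)
    (hs' : s ≠ 1 / 2) :
    ∃ c : V, (fun x : ℝ => hurwitzCont ℓ U h p q s x - (x : ℂ) ^ (1 - 2 * s) • c) =O[atTop]
      fun x : ℝ => (x : ℂ) ^ (-2 * s) := by
  have hℓ := H.ℓ_pos
  have hl : (ℓ : ℂ) ≠ 0 := by exact_mod_cast hℓ.ne'
  have hc : 1 - 2 * s ≠ 0 := by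
    intro h0
    apply hs'
    linear_combination -h0 / 2
  have hX := H.X_pos
  obtain ⟨K, hK0, hK⟩ := H.norm_term_le ‖s‖
  set C₁ := 3 / 2 * ‖1 - 2 * s‖ * Real.exp ‖1 - 2 * s‖
  set C₂ := 3 / 2 * ‖-2 * s‖ * Real.exp ‖-2 * s‖
  refine ⟨-((1 / (ℓ * (1 - 2 * s))) • p), IsBigO.of_bound
    (C₁ * ℓ / ‖(ℓ : ℂ) * (1 - 2 * s)‖ * ‖p‖ + (C₂ * (1 / 2) + 1) * ‖q‖ + K / (2 * s.re * ℓ)) ?_⟩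
  filter_upwards [eventually_ge_atTop X] with x hx
  have hx0 : 0 < x := hX.trans_le hx
  have hx0' : (x : ℂ) ≠ 0 := by exact_mod_cast hx0.ne'
  have hre : 0 < (x : ℂ).re := by simpa using hx0
  have hnz : ‖(ℓ / x : ℂ)‖ = ℓ / x := by
    rw [norm_div, Complex.norm_real, Complex.norm_real, Real.norm_of_nonneg hℓ.le,
      Real.norm_of_nonneg hx0.le]
  have hz : ‖(ℓ / x : ℂ)‖ ≤ 1 / 2 := by
    rw [hnz, div_le_iff₀ hx0]
    linarith [H.two_mul_le]
  set E : ℂ := (x : ℂ) ^ (-2 * s) with hE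
  have hEn : ‖E‖ = x ^ (-(2 * s.re)) := by
    rw [hE, Complex.norm_cpow_eq_rpow_re_of_pos hx0]
    congr 1
    simp
  have e1 : (x : ℂ) ^ (1 - 2 * s) = x * E := by
    rw [sub_eq_add_neg, Complex.cpow_add _ _ hx0', Complex.cpow_one, hE, neg_mul]
  have hT : ‖∑' n : ℕ, (U ^ (n + 1)) (approxErr ℓ U h p q s (x + ((n : ℂ) + 1) * ℓ))‖ ≤
      K / (2 * s.re * ℓ) * ‖E‖ := by
    have hsm := (summable_rpow hx0 hℓ (by linarith : 0 < 2 * s.re)).mul_left K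
    refine (tsum_of_norm_bounded hsm.hasSum
      fun n => hK s le_rfl hs' _ hs le_rfl x hx x (by simp) n).trans ?_
    rw [tsum_mul_left, hEn]
    calc _ ≤ K * (x ^ (-(2 * s.re)) / (2 * s.re * ℓ)) := by
          gcongr
          exact tsum_rpow_le hx0 hℓ (by linarith)
      _ = _ := by ring
  have e2 : hurwitzCont ℓ U h p q s x - (x : ℂ) ^ (1 - 2 * s) • -((1 / (ℓ * (1 - 2 * s))) • p) =
      -((E * (((1 + ℓ / x) ^ (1 - 2 * s) - 1) * x / (ℓ * (1 - 2 * s)))) • p) -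
      (E * ((1 + ℓ / x) ^ (-2 * s) - 1 + 1)) • U q +
      ∑' n : ℕ, (U ^ (n + 1)) (approxErr ℓ U h p q s (x + ((n : ℂ) + 1) * ℓ)) := by
    rw [hurwitzCont, approxPrim, add_cpow_eq_mul_one_add_cpow hre hℓ,
      add_cpow_eq_mul_one_add_cpow hre hℓ, map_add, map_smul, map_smul, H.map_p, e1, ← hE]
    have e3 : x * E * (1 + ℓ / x) ^ (1 - 2 * s) / (ℓ * (1 - 2 * s)) =
      E * (((1 + ℓ / x) ^ (1 - 2 * s) - 1) * x / (ℓ * (1 - 2 * s))) +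
        x * E * (1 / (ℓ * (1 - 2 * s))) := by ring
    rw [e3]
    module
  rw [e2]
  have b1 : ‖(E * (((1 + ℓ / x) ^ (1 - 2 * s) - 1) * x / (ℓ * (1 - 2 * s)))) • p‖ ≤
      C₁ * ℓ / ‖(ℓ : ℂ) * (1 - 2 * s)‖ * ‖p‖ * ‖E‖ := by
    rw [norm_smul, norm_mul, norm_div, norm_mul (_ - _), Complex.norm_real,
      Real.norm_of_nonneg hx0.le]
    calc _ ≤ ‖E‖ * ((C₁ * ‖(ℓ / x : ℂ)‖) * x / ‖(ℓ : ℂ) * (1 - 2 * s)‖) * ‖p‖ := by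
          gcongr
          exact norm_one_add_cpow_sub_one_le le_rfl hz
      _ = _ := by
          rw [hnz]
          field_simp
  have b2 : ‖(E * ((1 + ℓ / x) ^ (-2 * s) - 1 + 1)) • U q‖ ≤
      (C₂ * (1 / 2) + 1) * ‖q‖ * ‖E‖ := by
    rw [norm_smul, norm_mul, U.norm_map]
    calc _ ≤ ‖E‖ * (C₂ * (1 / 2) + 1) * ‖q‖ := by
          gcongr
          refine (norm_add_le _ _).trans ?_
          rw [norm_one]
          gcongr
          refine (norm_one_add_cpow_sub_one_le le_rfl hz).trans ?_
          gcongr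
      _ = _ := by ring
  refine (norm_add_le _ _).trans ((add_le_add (norm_sub_le _ _) hT).trans ?_)
  rw [norm_neg]
  linarith

end HurwitzData

end Hurwitz

section FastOne

variable {V : Type*} [NormedAddCommGroup V] [InnerProductSpace ℂ V] {ℓ : ℝ}

/-! ### The operator `L_{1,s}^{fast}` -/

lemma zeroExt_changeParam (s t : ℂ) (f : Ioi (ℓ - 1) → V) {y : ℝ} (hy : ℓ - 1 < y) :
    zeroExt (changeParam s t f) y = (y : ℂ) ^ (-2 * (t - s)) • zeroExt f y := by
  rw [zeroExt_of_mem _ (mem_Ioi.mpr hy), zeroExt_of_mem _ (mem_Ioi.mpr hy), changeParam]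

lemma eq_cpow_smul_of_holB₂ (hℓ : 2 < ℓ) {s : ℂ} {f : Ioi (ℓ - 1) → V} {h : ℂ → V}
    (hf : ∀ w ∈ Ioo (0 : ℝ) (1 / (ℓ - 1)), h (w : ℂ) = (w : ℂ) ^ (-2 * s) • zeroExt f (1 / w))
    {y : ℝ} (hy : ℓ - 1 < y) : zeroExt f y = (y : ℂ) ^ (-2 * s) • h (1 / (y : ℂ)) := by
  have hy0 : 0 < y := by linarith
  have hy0' : (y : ℂ) ≠ 0 := by exact_mod_cast hy0.ne'
  have hw := hf (1 / y) ⟨by positivity, one_div_lt_one_div_of_lt (by linarith) hy⟩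
  rw [one_div_one_div] at hw
  have e : ((1 / y : ℝ) : ℂ) ^ (-2 * s) = ((y : ℂ) ^ (-2 * s))⁻¹ := by
    rw [Complex.ofReal_div, Complex.ofReal_one, one_div, Complex.inv_cpow]
    rw [Complex.arg_ofReal_of_nonneg hy0.le]
    exact Real.pi_pos.ne
  have h0 : (y : ℂ) ^ (-2 * s) ≠ 0 := by
    rw [Complex.cpow_def_of_ne_zero hy0']
    exact Complex.exp_ne_zero _
  rw [e, Complex.ofReal_div, Complex.ofReal_one] at hw
  rw [hw, smul_inv_smul₀ h0]

lemma changeParam_eq_cpow_smul (hℓ : 2 < ℓ) {s : ℂ} {f : Ioi (ℓ - 1) → V} {h : ℂ → V}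
    (hf : ∀ w ∈ Ioo (0 : ℝ) (1 / (ℓ - 1)), h (w : ℂ) = (w : ℂ) ^ (-2 * s) • zeroExt f (1 / w))
    (t : ℂ) {y : ℝ} (hy : ℓ - 1 < y) :
    zeroExt (changeParam s t f) y = (y : ℂ) ^ (-2 * t) • h (1 / (y : ℂ)) := by
  have hy0 : (y : ℂ) ≠ 0 := by exact_mod_cast (by linarith : 0 < y).ne'
  rw [zeroExt_changeParam s t f hy, eq_cpow_smul_of_holB₂ hℓ hf hy, smul_smul,
    ← Complex.cpow_add _ _ hy0]
  congr 2
  ring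

variable {χ : triangleGroup ℓ →* (V ≃ₗᵢ[ℂ] V)} {s : ℂ} {f : Ioi (ℓ - 1) → V}

/-- The first summand of the series split off; with `v = L_{1,s}^{fast} f (x + ℓ)` this is
`L_{1,s}^{fast} = α_s(a₁⁻¹) (1 + L_{1,s}^{fast})`. -/
lemma HasFastOne.of_add (hℓ : 2 < ℓ) {x : ℝ} {v : V} (hx : -1 < x)
    (hv : HasFastOne s χ f (x + ℓ) v) :
    HasFastOne s χ f x (χ (a₁ ℓ)⁻¹ (zeroExt f (x + ℓ) + v)) := by
  obtain ⟨F, hF, hs, rfl⟩ := hv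
  have hy : ℓ - 1 < x + ℓ := by linarith
  have hx0 : ((x + ℓ : ℝ) : ℂ) ≠ 0 := by exact_mod_cast (by linarith : 0 < x + ℓ).ne'
  refine ⟨fun t => χ (a₁ ℓ)⁻¹ (((x + ℓ : ℝ) : ℂ) ^ (-2 * (t - s)) • zeroExt f (x + ℓ) + F t),
    ?_, fun t ht => ?_, by simp⟩
  · refine (χ (a₁ ℓ)⁻¹).differentiable.comp_differentiableOn
      (DifferentiableOn.add (DifferentiableOn.smul_const ?_ _) hF)
    exact DifferentiableOn.const_cpow (by fun_prop) (Or.inl hx0)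
  · rw [← hasSum_nat_add_iff' 1]
    have h1 := ((χ (a₁ ℓ)⁻¹).toContinuousLinearEquiv : V →L[ℂ] V).hasSum (hs t ht)
    convert! h1 using 1
    · funext n
      simp only [alpha_a₁_inv_pow]
      rw [pow_succ' _ (n + 1), LinearIsometryEquiv.coe_mul, Function.comp_apply]
      have e : x + ((n + 1 + 1 : ℕ) : ℝ) * ℓ = x + ℓ + ((n + 1 : ℕ) : ℝ) * ℓ := by
        push_cast
        ring
      rw [e]
      rfl
    · simp only [Finset.sum_range_one, zero_add, pow_one, alpha_a₁_inv, map_add,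
        zeroExt_changeParam s t f hy, add_sub_cancel_left]
      rfl

lemma analyticAt_map_isometry (U : V ≃ₗᵢ[ℂ] V) {g : ℝ → V} {x : ℝ} (hg : AnalyticAt ℝ g x) :
    AnalyticAt ℝ (fun y => U (g y)) x :=
  (((U.toContinuousLinearEquiv : V →L[ℂ] V).restrictScalars ℝ).analyticAt _).comp hg

lemma isBigO_zeroExt_of_mem_holB₂ (hℓ : 2 < ℓ) (hf : f ∈ holB₂ V ℓ s) :
    zeroExt f =O[atTop] fun x : ℝ => (x : ℂ) ^ (-2 * s) := by
  obtain ⟨O, h, hO, hmem, hh, hf'⟩ := hf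
  have h1 : 0 < 1 / (ℓ - 1) := one_div_pos.mpr (by linarith)
  have h0 : (0 : ℂ) ∈ O := by simpa using hmem 0 ⟨le_rfl, h1.le⟩
  have hcont : ContinuousAt h 0 := (hh.differentiableAt (hO.mem_nhds h0)).continuousAt
  have hlim : Tendsto (fun x : ℝ => 1 / (x : ℂ)) atTop (nhds 0) := by
    have := (Complex.continuous_ofReal.tendsto 0).comp tendsto_inv_atTop_zero
    simpa [Function.comp_def] using this
  have hb : (fun x : ℝ => h (1 / (x : ℂ))) =O[atTop] fun _ => (1 : ℂ) :=
    (hcont.tendsto.comp hlim).isBigO_one ℂ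
  refine ((isBigO_refl (fun x : ℝ => (x : ℂ) ^ (-2 * s)) atTop).smul hb).congr' ?_ ?_
  · filter_upwards [eventually_gt_atTop (ℓ - 1)] with x hx
    exact (eq_cpow_smul_of_holB₂ hℓ hf' hx).symm
  · simp

variable [FiniteDimensional ℂ V]

/-- Far to the right `L_{1,s}^{fast} f` is given by `hurwitzCont`. -/
lemma hasFastOne_hurwitzCont (hℓ : 2 < ℓ) {h : ℂ → V} {p q : V} {X : ℝ}
    (H : HurwitzData ℓ (χ (a₁ ℓ)⁻¹) h p q X)
    (hf : ∀ w ∈ Ioo (0 : ℝ) (1 / (ℓ - 1)), h (w : ℂ) = (w : ℂ) ^ (-2 * s) • zeroExt f (1 / w))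
    {x : ℝ} (hx : X ≤ x) :
    HasFastOne s χ f x (hurwitzCont ℓ (χ (a₁ ℓ)⁻¹) h p q s x) := by
  refine ⟨fun t => hurwitzCont ℓ (χ (a₁ ℓ)⁻¹) h p q t x, H.differentiableOn_param hx,
    fun t ht => ?_, rfl⟩
  convert! H.hasSum ht hx using 1
  funext n
  have hn : 0 ≤ (n : ℝ) * ℓ := by positivity
  have hy : ℓ - 1 < x + ((n + 1 : ℕ) : ℝ) * ℓ := by
    push_cast
    linarith [H.one_le]
  rw [alpha_a₁_inv_pow, changeParam_eq_cpow_smul hℓ hf t hy]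
  push_cast
  rfl

lemma exists_hasFastOne (hℓ : 2 < ℓ) (hf : f ∈ holB₂ V ℓ s) {x : ℝ} (hx : -1 < x) :
    ∃ v, HasFastOne s χ f x v := by
  obtain ⟨O, h, hO, hmem, hh, hf'⟩ := hf
  have h1 : 0 < 1 / (ℓ - 1) := one_div_pos.mpr (by linarith)
  have h0 : (0 : ℂ) ∈ O := by simpa using hmem 0 ⟨le_rfl, h1.le⟩
  obtain ⟨p, q, X, H⟩ := exists_hurwitzData (by linarith : 0 < ℓ) (χ (a₁ ℓ)⁻¹) hO h0 hh
  have key : ∀ N : ℕ, ∀ x : ℝ, -1 < x → X ≤ x + N * ℓ → ∃ v, HasFastOne s χ f x v := by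
    intro N
    induction N with
    | zero => exact fun x _ hX => ⟨_, hasFastOne_hurwitzCont hℓ H hf' (by simpa using hX)⟩
    | succ N ih =>
      intro x hx hX
      obtain ⟨v, hv⟩ := ih (x + ℓ) (by linarith) (by push_cast at hX; linarith)
      exact ⟨_, hv.of_add hℓ hx⟩
  obtain ⟨N, hN⟩ := exists_nat_ge ((X - x) / ℓ)
  rw [div_le_iff₀ (by linarith)] at hN
  exact key N x hx (by linarith)

open Classical in
/-- `L_{1,s}^{fast} f (x)`, with the value `0` where it is not defined. -/
def fastOne (s : ℂ) (χ : triangleGroup ℓ →* (V ≃ₗᵢ[ℂ] V)) (f : Ioi (ℓ - 1) → V) (x : ℝ) : V :=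
  if h : ∃ v, HasFastOne s χ f x v then h.choose else 0

lemma HasFastOne.fastOne_eq (hs : 0 < s.re) (hs' : s ≠ 1 / 2) {x : ℝ} {v : V}
    (hv : HasFastOne s χ f x v) : fastOne s χ f x = v := by
  have h : ∃ v, HasFastOne s χ f x v := ⟨v, hv⟩
  rw [fastOne, dif_pos h]
  exact h.choose_spec.unique hs hs' hv

lemma hasFastOne_fastOne (hℓ : 2 < ℓ) (hf : f ∈ holB₂ V ℓ s) {x : ℝ} (hx : -1 < x) :
    HasFastOne s χ f x (fastOne s χ f x) := by
  have h := exists_hasFastOne (χ := χ) hℓ hf hx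
  rw [fastOne, dif_pos h]
  exact h.choose_spec

lemma fastOne_eq_map_add (hℓ : 2 < ℓ) (hs : 0 < s.re) (hs' : s ≠ 1 / 2) (hf : f ∈ holB₂ V ℓ s)
    {x : ℝ} (hx : -1 < x) :
    fastOne s χ f x = χ (a₁ ℓ)⁻¹ (zeroExt f (x + ℓ) + fastOne s χ f (x + ℓ)) :=
  ((hasFastOne_fastOne hℓ hf (by linarith : -1 < x + ℓ)).of_add hℓ hx).fastOne_eq hs hs'

lemma analyticAt_zeroExt_of_mem_holB₂ (hℓ : 2 < ℓ) (hf : f ∈ holB₂ V ℓ s) {y : ℝ}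
    (hy : ℓ - 1 < y) : AnalyticAt ℝ (zeroExt f) y := by
  have : CompleteSpace V := FiniteDimensional.complete ℂ V
  obtain ⟨O, h, hO, hmem, hh, hf'⟩ := hf
  have hy0 : 0 < y := by linarith
  have h1 : AnalyticAt ℝ (fun z : ℝ => h (z : ℂ)) (1 / y) :=
    analyticAt_comp_ofReal_of_differentiableOn hO hh
      (hmem _ ⟨by positivity, one_div_le_one_div_of_le (by linarith) hy.le⟩)
  have h2 : AnalyticAt ℝ (fun z : ℝ => 1 / z) y :=
    analyticAt_const.div analyticAt_id hy0.ne'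
  refine ((analyticAt_cpow_const analyticAt_id hy0 (-2 * s)).smul (h1.comp h2)).congr ?_
  filter_upwards [lt_mem_nhds hy] with z hz
  rw [eq_cpow_smul_of_holB₂ hℓ hf' hz]
  simp

lemma analyticAt_fastOne (hℓ : 2 < ℓ) (hs : 0 < s.re) (hs' : s ≠ 1 / 2) (hf : f ∈ holB₂ V ℓ s)
    {x : ℝ} (hx : -1 < x) : AnalyticAt ℝ (fastOne s χ f) x := by
  have : CompleteSpace V := FiniteDimensional.complete ℂ V
  obtain ⟨O, h, hO, hmem, hh, hf'⟩ := id hf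
  have h1 : 0 < 1 / (ℓ - 1) := one_div_pos.mpr (by linarith)
  have h0 : (0 : ℂ) ∈ O := by simpa using hmem 0 ⟨le_rfl, h1.le⟩
  obtain ⟨p, q, X, H⟩ := exists_hurwitzData (by linarith : 0 < ℓ) (χ (a₁ ℓ)⁻¹) hO h0 hh
  have key : ∀ N : ℕ, ∀ x : ℝ, -1 < x → X < x + N * ℓ → AnalyticAt ℝ (fastOne s χ f) x := by
    intro N
    induction N with
    | zero =>
      intro x _ hX
      rw [Nat.cast_zero, zero_mul, add_zero] at hX
      refine (analyticAt_comp_ofReal_of_differentiableOn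
        (isOpen_lt continuous_const Complex.continuous_re) (H.differentiableOn_point hs hs')
        (x := x) (by simpa using hX)).congr ?_
      filter_upwards [lt_mem_nhds hX] with z hz
      exact ((hasFastOne_hurwitzCont hℓ H hf' hz.le).fastOne_eq hs hs').symm
    | succ N ih =>
      intro x hx hX
      have hadd : AnalyticAt ℝ (fun z : ℝ => z + ℓ) x := analyticAt_id.add analyticAt_const
      have h1 := (analyticAt_zeroExt_of_mem_holB₂ hℓ hf
        (by linarith : ℓ - 1 < x + ℓ)).comp_of_eq (f := fun z : ℝ => z + ℓ) hadd rfl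
      have h2 := (ih (x + ℓ) (by linarith) (by push_cast at hX; linarith)).comp_of_eq
        (f := fun z : ℝ => z + ℓ) hadd rfl
      refine (analyticAt_map_isometry (χ (a₁ ℓ)⁻¹) (h1.add h2)).congr ?_
      filter_upwards [lt_mem_nhds hx] with z hz
      exact (fastOne_eq_map_add hℓ hs hs' hf hz).symm
  obtain ⟨N, hN⟩ := exists_nat_gt ((X - x) / ℓ)
  rw [div_lt_iff₀ (by linarith)] at hN
  exact key N x hx (by linarith)

lemma isBigO_fastOne (hℓ : 2 < ℓ) (hs : 0 < s.re) (hs' : s ≠ 1 / 2) (hf : f ∈ holB₂ V ℓ s) :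
    ∃ c : V, (fun x : ℝ => fastOne s χ f x - (x : ℂ) ^ (1 - 2 * s) • c) =O[atTop]
      fun x : ℝ => (x : ℂ) ^ (-2 * s) := by
  obtain ⟨O, h, hO, hmem, hh, hf'⟩ := hf
  have h1 : 0 < 1 / (ℓ - 1) := one_div_pos.mpr (by linarith)
  have h0 : (0 : ℂ) ∈ O := by simpa using hmem 0 ⟨le_rfl, h1.le⟩
  obtain ⟨p, q, X, H⟩ := exists_hurwitzData (by linarith : 0 < ℓ) (χ (a₁ ℓ)⁻¹) hO h0 hh
  obtain ⟨c, hc⟩ := H.isBigO hs hs'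
  refine ⟨c, hc.congr' ?_ EventuallyEq.rfl⟩
  filter_upwards [eventually_ge_atTop X] with x hx
  rw [(hasFastOne_hurwitzCont hℓ H hf' hx).fastOne_eq hs hs']

end FastOne

/-! ### Quasi-periodic functions with power asymptotics vanish -/

lemma tendsto_add_cpow_sub_cpow {s : ℂ} (hs : 0 < s.re) {ℓ : ℝ} (hℓ : 0 < ℓ) :
    Tendsto (fun y : ℝ => ((y + ℓ : ℝ) : ℂ) ^ (1 - 2 * s) - (y : ℂ) ^ (1 - 2 * s)) atTop
      (nhds 0) := by
  set C := 3 / 2 * ‖1 - 2 * s‖ * Real.exp ‖1 - 2 * s‖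
  have hlim : Tendsto (fun y : ℝ => C * ℓ * y ^ (-(2 * s.re))) atTop (nhds 0) := by
    simpa using (tendsto_rpow_neg_atTop (by linarith : 0 < 2 * s.re)).const_mul (C * ℓ)
  refine squeeze_zero_norm' ?_ hlim
  filter_upwards [eventually_ge_atTop (2 * ℓ)] with y hy
  have hy0 : 0 < y := by linarith
  have hnz : ‖(ℓ / y : ℂ)‖ = ℓ / y := by
    rw [norm_div, Complex.norm_real, Complex.norm_real, Real.norm_of_nonneg hℓ.le,
      Real.norm_of_nonneg hy0.le]
  have hz : ‖(ℓ / y : ℂ)‖ ≤ 1 / 2 := by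
    rw [hnz, div_le_iff₀ hy0]
    linarith
  rw [Complex.ofReal_add, add_cpow_eq_mul_one_add_cpow (by simpa using hy0) hℓ, ← mul_sub_one,
    norm_mul, Complex.norm_cpow_eq_rpow_re_of_pos hy0]
  have e : y ^ (1 - 2 * s).re = y ^ (-(2 * s.re)) * y := by
    rw [show (1 - 2 * s).re = -(2 * s.re) + 1 by simp; ring, Real.rpow_add_one hy0.ne']
  rw [e]
  calc _ ≤ y ^ (-(2 * s.re)) * y * (C * ‖(ℓ / y : ℂ)‖) := by
        gcongr
        exact norm_one_add_cpow_sub_one_le le_rfl hz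
    _ = _ := by
        rw [hnz]
        field_simp

/-- The exponent `a log(1 + 1 / k)` is too small to be a non-zero multiple of `2 π i`. -/
lemma one_add_one_div_cpow_ne_one {a : ℂ} (ha : a ≠ 0) {k : ℕ} (hk : ‖a‖ < k) :
    ((1 + 1 / k : ℝ) : ℂ) ^ a ≠ 1 := by
  have hk0 : (0 : ℝ) < k := (norm_nonneg a).trans_lt hk
  have h1 : (0 : ℝ) < 1 + 1 / k := by positivity
  have hlog : 0 < Real.log (1 + 1 / k) := Real.log_pos (by
    have : (0 : ℝ) < 1 / k := by positivity
    linarith)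
  have hlog' : Real.log (1 + 1 / k) ≤ 1 / k := by
    have := Real.log_le_sub_one_of_pos h1
    linarith
  rw [Complex.cpow_def_of_ne_zero (by exact_mod_cast h1.ne'), ← Complex.ofReal_log h1.le]
  intro h
  obtain ⟨n, hn⟩ := Complex.exp_eq_one_iff.mp h
  have hnorm : ‖((Real.log (1 + 1 / k) : ℝ) : ℂ) * a‖ < 1 := by
    rw [norm_mul, Complex.norm_real, Real.norm_of_nonneg hlog.le]
    calc _ ≤ 1 / k * ‖a‖ := by gcongr
      _ < 1 := by
        rw [one_div_mul_eq_div, div_lt_one hk0]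
        exact hk
  have hne : ((Real.log (1 + 1 / k) : ℝ) : ℂ) * a ≠ 0 :=
    mul_ne_zero (by exact_mod_cast hlog.ne') ha
  rw [hn] at hnorm hne
  have hn0 : n ≠ 0 := by
    rintro rfl
    simp at hne
  have h1n : (1 : ℝ) ≤ |(n : ℝ)| := by exact_mod_cast Int.one_le_abs hn0
  rw [norm_mul, Complex.norm_intCast, norm_mul, norm_mul, Complex.norm_I, Complex.norm_real,
    Real.norm_of_nonneg Real.pi_pos.le, Complex.norm_ofNat, mul_one] at hnorm
  nlinarith [Real.pi_gt_three]

lemma tendsto_cpow_ratio (x : ℝ) {ℓ : ℝ} (hℓ : 0 < ℓ) (a : ℂ) {k : ℕ} (hk : 0 < k) :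
    Tendsto (fun m : ℕ => (((x + ((k + 1) * m : ℕ) * ℓ) / (x + (k * m : ℕ) * ℓ) : ℝ) : ℂ) ^ a)
      atTop (nhds (((1 + 1 / k : ℝ) : ℂ) ^ a)) := by
  have hk' : (0 : ℝ) < k := by exact_mod_cast hk
  have hinv : Tendsto (fun m : ℕ => x / m) atTop (nhds 0) :=
    tendsto_const_div_atTop_nhds_zero_nat x
  have h1 : Tendsto (fun m : ℕ => (x / m + (k + 1) * ℓ) / (x / m + k * ℓ)) atTop
      (nhds ((0 + (k + 1) * ℓ) / (0 + k * ℓ))) :=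
    (hinv.add_const _).div (hinv.add_const _) (by rw [zero_add]; positivity)
  have e : (0 + ((k : ℝ) + 1) * ℓ) / (0 + k * ℓ) = 1 + 1 / k := by
    field_simp
    ring
  rw [e] at h1
  have h2 : Tendsto (fun m : ℕ => (x + ((k + 1) * m : ℕ) * ℓ) / (x + (k * m : ℕ) * ℓ)) atTop
      (nhds (1 + 1 / (k : ℝ))) := by
    refine h1.congr' ?_
    filter_upwards [eventually_gt_atTop 0] with m hm
    have hm' : (m : ℝ) ≠ 0 := by exact_mod_cast hm.ne'
    rw [← mul_div_mul_right _ _ hm']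
    push_cast
    congr 1 <;> field_simp
  have h3 : (0 : ℝ) < 1 + 1 / k := by positivity
  exact (((continuousAt_id.cpow continuousAt_const
    (Complex.ofReal_mem_slitPlane.mpr h3) : ContinuousAt (fun z : ℂ => z ^ a) _).tendsto).comp
    (Complex.continuous_ofReal.tendsto _)).comp h2

section Uniqueness

variable {V : Type*} [NormedAddCommGroup V] [InnerProductSpace ℂ V]

/-- A solution of `ψ(x) = U ψ(x + ℓ)` with `ψ(x) = c x ^ (1 - 2 s) + O(x ^ (-2 s))` vanishes. The
norm of `ψ(x + (n + 1) ℓ) - ψ(x + n ℓ)` does not depend on `n` and tends to `0`, so the sequence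
`ψ(x + n ℓ)` is constant. Since `s ≠ 1 / 2`, a non-zero multiple of `(x + n ℓ) ^ (1 - 2 s)` has no
non-zero limit. -/
lemma eq_zero_of_quasiperiodic {U : V ≃ₗᵢ[ℂ] V} {ℓ b : ℝ} (hℓ : 0 < ℓ) {s : ℂ} (hs : 0 < s.re)
    (hs' : s ≠ 1 / 2) {ψ : ℝ → V} {c : V} (hψ : ∀ x, b < x → ψ x = U (ψ (x + ℓ)))
    (hO : (fun x : ℝ => ψ x - (x : ℂ) ^ (1 - 2 * s) • c) =O[atTop]
      fun x : ℝ => (x : ℂ) ^ (-2 * s)) {x : ℝ} (hx : b < x) : ψ x = 0 := by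
  have ha : 1 - 2 * s ≠ 0 := by
    intro h0
    apply hs'
    linear_combination -h0 / 2
  have hlin : Tendsto (fun n : ℕ => x + (n : ℝ) * ℓ) atTop atTop :=
    tendsto_atTop_add_const_left _ _ (Tendsto.atTop_mul_const hℓ tendsto_natCast_atTop_atTop)
  have hpow : Tendsto (fun y : ℝ => (y : ℂ) ^ (-2 * s)) atTop (nhds 0) := by
    rw [tendsto_zero_iff_norm_tendsto_zero]
    refine (tendsto_rpow_neg_atTop (by linarith : 0 < 2 * s.re)).congr' ?_
    filter_upwards [eventually_gt_atTop 0] with y hy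
    rw [Complex.norm_cpow_eq_rpow_re_of_pos hy]
    simp
  set g : ℕ → ℂ := fun n => ((x + n * ℓ : ℝ) : ℂ) ^ (1 - 2 * s) with hg
  have he : Tendsto (fun n : ℕ => ψ (x + n * ℓ) - g n • c) atTop (nhds 0) :=
    (hO.trans_tendsto hpow).comp hlin
  have hstep : ∀ n : ℕ, x + (n + 1 : ℕ) * ℓ = x + n * ℓ + ℓ := fun n => by
    push_cast
    ring
  have hrec : ∀ n : ℕ, ψ (x + n * ℓ) = U (ψ (x + (n + 1 : ℕ) * ℓ)) := by
    intro n
    have : 0 ≤ (n : ℝ) * ℓ := by positivity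
    rw [hstep]
    exact hψ _ (by linarith)
  have hgd : Tendsto (fun n : ℕ => g (n + 1) - g n) atTop (nhds 0) := by
    have := (tendsto_add_cpow_sub_cpow hs hℓ).comp hlin
    refine this.congr fun n => ?_
    simp only [hg, hstep, Function.comp_apply]
  have hd : Tendsto (fun n : ℕ => ψ (x + (n + 1 : ℕ) * ℓ) - ψ (x + n * ℓ)) atTop (nhds 0) := by
    have h1 := ((he.comp (tendsto_add_atTop_nat 1)).sub he).add (hgd.smul_const c)
    rw [sub_zero, zero_smul, add_zero] at h1
    refine h1.congr fun n => ?_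
    simp only [Function.comp_apply, sub_smul]
    abel
  have hnorm : ∀ n : ℕ, ‖ψ (x + (n + 1 : ℕ) * ℓ) - ψ (x + n * ℓ)‖ =
      ‖ψ (x + (0 + 1 : ℕ) * ℓ) - ψ (x + (0 : ℕ) * ℓ)‖ := by
    intro n
    induction n with
    | zero => rfl
    | succ n ih =>
      rw [← ih, ← U.norm_map (ψ (x + (n + 1 + 1 : ℕ) * ℓ) - _), map_sub, ← hrec, ← hrec]
  have hzero : ‖ψ (x + (0 + 1 : ℕ) * ℓ) - ψ (x + (0 : ℕ) * ℓ)‖ = 0 := by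
    have h1 := hd.norm
    simp_rw [hnorm] at h1
    rw [norm_zero] at h1
    exact tendsto_nhds_unique tendsto_const_nhds h1
  have hconst : ∀ n : ℕ, ψ (x + n * ℓ) = ψ x := by
    intro n
    induction n with
    | zero => simp
    | succ n ih =>
      rw [← ih]
      have := hnorm n
      rw [hzero] at this
      exact sub_eq_zero.mp (norm_eq_zero.mp this)
  have hgc : Tendsto (fun n : ℕ => g n • c) atTop (nhds (ψ x)) := by
    have h1 := (tendsto_const_nhds (x := ψ x)).sub he
    rw [sub_zero] at h1
    refine h1.congr fun n => ?_
    rw [hconst, sub_sub_cancel]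
  -- along `n = k m` and `n = (k + 1) m` the same limit is obtained, but the ratio of the terms
  -- tends to `(1 + 1 / k) ^ (1 - 2 s) ≠ 1`
  obtain ⟨k, hk⟩ := exists_nat_gt ‖1 - 2 * s‖
  have hk0 : 0 < k := by
    have : (0 : ℝ) < k := (norm_nonneg _).trans_lt hk
    exact_mod_cast this
  have hmul : ∀ j : ℕ, 0 < j → Tendsto (fun m : ℕ => j * m) atTop atTop := fun j hj =>
    tendsto_id.const_mul_atTop' hj
  have h1 := hgc.comp (hmul k hk0)
  have h2 := hgc.comp (hmul (k + 1) k.succ_pos)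
  have h3 := (tendsto_cpow_ratio x hℓ (1 - 2 * s) hk0).smul h1
  have h4 : ((1 + 1 / k : ℝ) : ℂ) ^ (1 - 2 * s) • ψ x = ψ x := by
    refine tendsto_nhds_unique (h3.congr' ?_) h2
    filter_upwards [(hlin.comp (hmul k hk0)).eventually_gt_atTop 0,
      (hlin.comp (hmul (k + 1) k.succ_pos)).eventually_gt_atTop 0] with m hm hm'
    simp only [Function.comp_apply] at hm hm' ⊢
    rw [smul_smul]
    congr 1
    simp only [hg]
    rw [← Complex.mul_cpow_ofReal_nonneg (div_pos hm' hm).le hm.le, ← Complex.ofReal_mul,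
      div_mul_cancel₀ _ hm.ne']
  have h5 : (((1 + 1 / k : ℝ) : ℂ) ^ (1 - 2 * s) - 1) • ψ x = 0 := by
    rw [sub_smul, one_smul, h4, sub_self]
  exact (smul_eq_zero.mp h5).resolve_left
    (sub_ne_zero.mpr (one_add_one_div_cpow_ne_one ha hk))

end Uniqueness

section Correspondence

variable {V : Type*} [NormedAddCommGroup V] [InnerProductSpace ℂ V] {ℓ : ℝ}
  {χ : triangleGroup ℓ →* (V ≃ₗᵢ[ℂ] V)} {s : ℂ} {ε : ℤˣ}

/-! ### Regularity of `(α_s(a₂) ± α_s(a₂ J)) f` -/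

lemma analyticAt_hyp {I : Set ℝ} {f : I → V} (hf : AnalyticOnNhd ℝ (zeroExt f) (Ioo (-1) 1))
    {x : ℝ} (hx : 1 < x + ℓ) : AnalyticAt ℝ (hyp s χ ε f) x := by
  have h0 : 0 < x + ℓ := by linarith
  have h1 : 1 / (x + ℓ) < 1 := by rwa [div_lt_one h0]
  have h2 : 0 < 1 / (x + ℓ) := by positivity
  have hadd : AnalyticAt ℝ (fun y : ℝ => y + ℓ) x := analyticAt_id.add analyticAt_const
  have hA : AnalyticAt ℝ (fun y : ℝ => zeroExt f (-1 / (y + ℓ))) x :=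
    (hf _ ⟨by rw [neg_div]; linarith, by rw [neg_div]; linarith⟩).comp_of_eq
      (f := fun y : ℝ => -1 / (y + ℓ)) (analyticAt_const.div hadd h0.ne') rfl
  have hB : AnalyticAt ℝ (fun y : ℝ => zeroExt f (1 / (y + ℓ))) x :=
    (hf _ ⟨by linarith, h1⟩).comp_of_eq
      (f := fun y : ℝ => 1 / (y + ℓ)) (analyticAt_const.div hadd h0.ne') rfl
  refine ((analyticAt_cpow_const hadd h0 (-2 * s)).smul
    ((analyticAt_map_isometry (χ (a₂ ℓ)) hA).add ((analyticAt_const (v := ((ε : ℤ) : ℂ))).smul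
      (analyticAt_map_isometry (χ (a₂ ℓ * elJ ℓ)) hB)))).congr ?_
  filter_upwards [lt_mem_nhds (by linarith : -ℓ < x)] with y hy
  exact (hyp_eq s χ ε f (by linarith)).symm

lemma analyticOnNhd_of_mem_holB₁ [FiniteDimensional ℂ V] {f : Ioo (-1 : ℝ) 1 → V}
    (hf : f ∈ holB₁ V) : AnalyticOnNhd ℝ (zeroExt f) (Ioo (-1) 1) := by
  have : CompleteSpace V := FiniteDimensional.complete ℂ V
  obtain ⟨U, F, hU, hmem, hF, hFf⟩ := hf
  intro x hx
  refine (analyticAt_comp_ofReal_of_differentiableOn hU hF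
    (hmem x ⟨hx.1.le, hx.2.le⟩)).congr ?_
  filter_upwards [isOpen_Ioo.mem_nhds hx] with y hy
  rw [zeroExt_of_mem f hy, hFf ⟨y, hy⟩]

/-- In the coordinate `w = 1 / x` the function is
`(1 + ℓ w) ^ (-2 s) (χ(a₂) f(-w / (1 + ℓ w)) ± χ(a₂ J) f(w / (1 + ℓ w)))`. -/
lemma hyp_mem_holB₂ (hℓ : 2 < ℓ) {f : Ioo (-1 : ℝ) 1 → V} (hf : f ∈ holB₁ V) :
    (fun x : Ioi (ℓ - 1) => hyp s χ ε f x) ∈ holB₂ V ℓ s := by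
  obtain ⟨U, F, hU, hmem, hF, hFf⟩ := hf
  have hF' : ∀ y ∈ Ioo (-1 : ℝ) 1, zeroExt f y = F y := fun y hy => by
    rw [zeroExt_of_mem f hy, hFf ⟨y, hy⟩]
  let S : Set ℂ := {w | 1 + ℓ * w ∈ Complex.slitPlane}
  have hS : IsOpen S := Complex.isOpen_slitPlane.preimage (by fun_prop)
  let m : ℂ → ℂ := fun w => w / (1 + ℓ * w)
  have hm : DifferentiableOn ℂ m S := fun w hw =>
    (DifferentiableAt.div (c := fun w : ℂ => w) (d := fun w : ℂ => 1 + (ℓ : ℂ) * w)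
      (by fun_prop) (by fun_prop) (Complex.slitPlane_ne_zero hw)).differentiableWithinAt
  have hO := hm.continuousOn.isOpen_inter_preimage hS hU
  have hO' := hm.neg.continuousOn.isOpen_inter_preimage hS hU
  have hreal : ∀ w : ℝ, 0 ≤ w → (w : ℂ) ∈ S ∧ m w = ((w / (1 + ℓ * w) : ℝ) : ℂ) ∧
      0 < 1 + ℓ * w ∧ 0 ≤ w / (1 + ℓ * w) ∧ w / (1 + ℓ * w) < 1 := by
    intro w hw
    have h1 : 0 < 1 + ℓ * w := by nlinarith
    refine ⟨?_, by simp [m], h1, by positivity, ?_⟩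
    · have : ((1 + ℓ * w : ℝ) : ℂ) ∈ Complex.slitPlane := Complex.ofReal_mem_slitPlane.mpr h1
      simpa [S] using this
    · rw [div_lt_one h1]
      nlinarith
  refine ⟨(S ∩ m ⁻¹' U) ∩ (S ∩ (-m) ⁻¹' U), fun w => (1 + ℓ * w) ^ (-2 * s) •
    (χ (a₂ ℓ) (F (-m w)) + ((ε : ℤ) : ℂ) • χ (a₂ ℓ * elJ ℓ) (F (m w))), hO.inter hO',
    fun w hw => ?_, ?_, fun w hw => ?_⟩
  · obtain ⟨h1, h2, -, h3, h4⟩ := hreal w hw.1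
    refine ⟨⟨h1, ?_⟩, ⟨h1, ?_⟩⟩
    · rw [mem_preimage, h2]
      exact hmem _ ⟨by linarith, h4.le⟩
    · rw [mem_preimage, Pi.neg_apply, h2, ← Complex.ofReal_neg]
      exact hmem _ ⟨by linarith, by linarith⟩
  · rintro w ⟨⟨h1, h2⟩, -, h3⟩
    have dm : DifferentiableAt ℂ m w := hm.differentiableAt (hS.mem_nhds h1)
    have d1 : DifferentiableAt ℂ (fun z => F (m z)) w :=
      DifferentiableAt.comp w (hF.differentiableAt (hU.mem_nhds h2)) dm
    have d2 : DifferentiableAt ℂ (fun z => F (-m z)) w :=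
      DifferentiableAt.comp w (g := F) (f := fun z => -m z)
        (hF.differentiableAt (hU.mem_nhds h3)) dm.neg
    have da : DifferentiableAt ℂ (fun z : ℂ => 1 + (ℓ : ℂ) * z) w := by fun_prop
    refine (DifferentiableAt.smul (da.cpow (differentiableAt_const _) h1)
      (DifferentiableAt.add ?_ (DifferentiableAt.const_smul ?_ _))).differentiableWithinAt
    · exact (χ (a₂ ℓ)).differentiable.differentiableAt.comp w d2
    · exact (χ (a₂ ℓ * elJ ℓ)).differentiable.differentiableAt.comp w d1
  · obtain ⟨-, h2, h0, h3, h4⟩ := hreal w hw.1.le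
    have hw0 : 0 < w := hw.1
    have h5 : 0 < w / (1 + ℓ * w) := by positivity
    have hx : ℓ - 1 < 1 / w := by
      rw [lt_one_div (by linarith) hw.1]
      exact hw.2
    have hxl : 0 < 1 / w + ℓ := by linarith
    have e1 : 1 / (1 / w + ℓ) = w / (1 + ℓ * w) := by
      field_simp
    have e2 : (w : ℂ) ^ (-2 * s) * ((1 / w + ℓ : ℝ) : ℂ) ^ (-2 * s) =
        (1 + ℓ * w) ^ (-2 * s) := by
      rw [← Complex.mul_cpow_ofReal_nonneg hw.1.le hxl.le, ← Complex.ofReal_mul]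
      congr 1
      rw [show w * (1 / w + ℓ) = 1 + ℓ * w by field_simp]
      push_cast
      rfl
    rw [zeroExt_of_mem _ (mem_Ioi.mpr hx), hyp_eq s χ ε f hxl, smul_smul, e2, neg_div, e1,
      hF' _ ⟨by linarith, by linarith⟩, hF' _ ⟨by linarith, h4⟩]
    simp only [h2, Complex.ofReal_neg]

/-! ### From fast to slow eigenfunctions -/

/-- The function `(α_s(a₂) ± α_s(a₂ J)) f₁ + L_{1,s}^{fast} f₂` on `(-1, ∞)`. For a fast
eigenfunction it extends `f₁` and `(1 + L_{1,s}^{fast}) f₂`, and it is also defined on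
`[1, ℓ - 1]`. -/
def toSlow (s : ℂ) (χ : triangleGroup ℓ →* (V ≃ₗᵢ[ℂ] V)) (ε : ℤˣ)
    (f : (Ioo (-1 : ℝ) 1 → V) × (Ioi (ℓ - 1) → V)) : Ioi (-1 : ℝ) → V :=
  fun x => hyp s χ ε f.1 x + fastOne s χ f.2 x

lemma zeroExt_toSlow (f : (Ioo (-1 : ℝ) 1 → V) × (Ioi (ℓ - 1) → V)) {x : ℝ} (hx : -1 < x) :
    zeroExt (toSlow s χ ε f) x = hyp s χ ε f.1 x + fastOne s χ f.2 x :=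
  zeroExt_of_mem _ hx

lemma zeroExt_toSlow_of_mem_Ioo [FiniteDimensional ℂ V] (hs : 0 < s.re) (hs' : s ≠ 1 / 2)
    {f : (Ioo (-1 : ℝ) 1 → V) × (Ioi (ℓ - 1) → V)} (hf : f ∈ FFE s χ ε) {x : ℝ}
    (hx : x ∈ Ioo (-1 : ℝ) 1) : zeroExt (toSlow s χ ε f) x = zeroExt f.1 x := by
  obtain ⟨v, hv, e⟩ := hf.2.1 ⟨x, hx⟩
  rw [zeroExt_toSlow f hx.1, zeroExt_of_mem f.1 hx, e, hv.fastOne_eq hs hs']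

lemma zeroExt_toSlow_of_lt (hℓ : 2 < ℓ) {f : (Ioo (-1 : ℝ) 1 → V) × (Ioi (ℓ - 1) → V)}
    (hf : f ∈ FFE s χ ε) {x : ℝ} (hx : ℓ - 1 < x) :
    zeroExt (toSlow s χ ε f) x = zeroExt f.2 x + fastOne s χ f.2 x := by
  rw [zeroExt_toSlow f (by linarith), zeroExt_of_mem f.2 (mem_Ioi.mpr hx), hf.2.2 ⟨x, hx⟩]

lemma toSlow_mem [FiniteDimensional ℂ V] (hℓ : 2 < ℓ) (hs : 0 < s.re) (hs' : s ≠ 1 / 2)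
    {f : (Ioo (-1 : ℝ) 1 → V) × (Ioi (ℓ - 1) → V)} (hf : f ∈ FFE s χ ε) :
    toSlow s χ ε f ∈ SFEas s χ ε := by
  have hB₂ : f.2 ∈ holB₂ V ℓ s := hf.1.2
  refine ⟨⟨fun x hx => ?_, ?_⟩, ?_⟩
  · have hx' : -1 < x := hx
    refine ((analyticAt_hyp (s := s) (χ := χ) (ε := ε) (analyticOnNhd_of_mem_holB₁ hf.1.1)
      (by linarith : 1 < x + ℓ)).add (analyticAt_fastOne (χ := χ) hℓ hs hs' hB₂ hx)).congr ?_
    filter_upwards [lt_mem_nhds hx'] with y hy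
    exact (zeroExt_toSlow f hy).symm
  · funext x
    have hx : -1 < (x : ℝ) := x.2
    rw [slowOp, alpha_a₁_inv, zeroExt_toSlow_of_lt hℓ hf (by linarith),
      ← fastOne_eq_map_add hℓ hs hs' hB₂ hx,
      hyp_congr s χ ε (fun y hy => zeroExt_toSlow_of_mem_Ioo hs hs' hf hy) (by linarith)]
    rfl
  · obtain ⟨c, hc⟩ := isBigO_fastOne (χ := χ) hℓ hs hs' hB₂
    refine ⟨c, ((isBigO_zeroExt_of_mem_holB₂ hℓ hB₂).add hc).congr' ?_ EventuallyEq.rfl⟩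
    filter_upwards [eventually_gt_atTop (ℓ - 1)] with x hx
    rw [zeroExt_toSlow_of_lt hℓ hf hx]
    abel

/-! ### From slow to fast eigenfunctions -/

/-- The pair of `φ` on `(-1, 1)` and `(1 - α_s(a₁⁻¹)) φ` on `(ℓ - 1, ∞)`. -/
def toFast (s : ℂ) (χ : triangleGroup ℓ →* (V ≃ₗᵢ[ℂ] V)) :
    (Ioi (-1 : ℝ) → V) →ₗ[ℂ] (Ioo (-1 : ℝ) 1 → V) × (Ioi (ℓ - 1) → V) where
  toFun φ := (fun x => zeroExt φ x, fun x => zeroExt φ x - alpha s χ (a₁ ℓ)⁻¹ φ x)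
  map_add' φ ψ := by
    ext x
    · simp [zeroExt_add]
    · simp only [zeroExt_add, alpha_add, Pi.add_apply, Prod.mk_add_mk]
      abel
  map_smul' c φ := by
    ext x
    · simp [zeroExt_smul]
    · simp [zeroExt_smul, alpha_smul, smul_sub]

lemma zeroExt_toFast_fst (φ : Ioi (-1 : ℝ) → V) {x : ℝ} (hx : x ∈ Ioo (-1 : ℝ) 1) :
    zeroExt (toFast s χ φ).1 x = zeroExt φ x :=
  zeroExt_of_mem _ hx

lemma zeroExt_toFast_snd (φ : Ioi (-1 : ℝ) → V) {x : ℝ} (hx : ℓ - 1 < x) :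
    zeroExt (toFast s χ φ).2 x = zeroExt φ x - alpha s χ (a₁ ℓ)⁻¹ φ x :=
  zeroExt_of_mem _ (mem_Ioi.mpr hx)

lemma zeroExt_eq_of_mem_SFE {φ : Ioi (-1 : ℝ) → V} (hφ : φ ∈ SFE s χ ε) {x : ℝ} (hx : -1 < x) :
    zeroExt φ x = hyp s χ ε φ x + χ (a₁ ℓ)⁻¹ (zeroExt φ (x + ℓ)) := by
  rw [zeroExt_of_mem φ (mem_Ioi.mpr hx)]
  nth_rewrite 1 [hφ.2]
  rw [slowOp, alpha_a₁_inv]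

/-- A slow eigenfunction extends analytically beyond the left end point `-1`, because the right-hand
side of its functional equation at `-1` reads it only at `± 1 / (ℓ - 1)` and `ℓ - 1`. -/
lemma toFast_fst_mem [FiniteDimensional ℂ V] (hℓ : 2 < ℓ) {φ : Ioi (-1 : ℝ) → V}
    (hφ : φ ∈ SFE s χ ε) : (toFast s χ φ).1 ∈ holB₁ V := by
  have : CompleteSpace V := FiniteDimensional.complete ℂ V
  let g : ℝ → V := fun x => hyp s χ ε φ x + χ (a₁ ℓ)⁻¹ (zeroExt φ (x + ℓ))
  have hg : AnalyticOnNhd ℝ g (Icc (-1) 1) := by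
    intro x hx
    have hadd : AnalyticAt ℝ (fun y : ℝ => y + ℓ) x := analyticAt_id.add analyticAt_const
    have hx1 := hx.1
    refine (analyticAt_hyp (fun y hy => hφ.1 y hy.1) (by linarith)).add
      (analyticAt_map_isometry _ ?_)
    exact (hφ.1 (x + ℓ) (show -1 < x + ℓ by linarith)).comp_of_eq (f := fun y : ℝ => y + ℓ)
      hadd rfl
  obtain ⟨U, F, hU, hmem, hF, hFg⟩ := exists_holomorphic_extension hg
  refine ⟨U, F, hU, hmem, hF, fun x => ?_⟩
  rw [hFg _ ⟨x.2.1.le, x.2.2.le⟩]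
  exact (zeroExt_eq_of_mem_SFE hφ x.2.1).symm

lemma toFast_snd_eq (hℓ : 2 < ℓ) {φ : Ioi (-1 : ℝ) → V} (hφ : φ ∈ SFE s χ ε) :
    (toFast s χ φ).2 = fun x : Ioi (ℓ - 1) => hyp s χ ε (toFast s χ φ).1 x := by
  funext x
  have hx : ℓ - 1 < (x : ℝ) := x.2
  rw [hyp_congr s χ ε (fun y hy => zeroExt_toFast_fst φ hy) (by linarith)]
  change zeroExt φ x - alpha s χ (a₁ ℓ)⁻¹ φ x = _
  rw [alpha_a₁_inv, zeroExt_eq_of_mem_SFE hφ (by linarith), add_sub_cancel_right]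

lemma toFast_snd_mem [FiniteDimensional ℂ V] (hℓ : 2 < ℓ) {φ : Ioi (-1 : ℝ) → V}
    (hφ : φ ∈ SFE s χ ε) : (toFast s χ φ).2 ∈ holB₂ V ℓ s := by
  rw [toFast_snd_eq hℓ hφ]
  exact hyp_mem_holB₂ hℓ (toFast_fst_mem hℓ hφ)

/-- The function `φ - (1 + L_{1,s}^{fast}) f₂` is invariant under `α_s(a₁⁻¹)` and has the
asymptotics of a slow eigenfunction, hence vanishes. -/
lemma fastOne_toFast_snd [FiniteDimensional ℂ V] (hℓ : 2 < ℓ) (hs : 0 < s.re) (hs' : s ≠ 1 / 2)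
    {φ : Ioi (-1 : ℝ) → V} (hφ : φ ∈ SFEas s χ ε) {x : ℝ} (hx : -1 < x) :
    fastOne s χ (toFast s χ φ).2 x = χ (a₁ ℓ)⁻¹ (zeroExt φ (x + ℓ)) := by
  have hB₂ := toFast_snd_mem hℓ hφ.1
  set f := (toFast s χ φ).2 with hf
  let ψ : ℝ → V := fun y => zeroExt φ y - (zeroExt f y + fastOne s χ f y)
  have hψ : ∀ y, ℓ - 1 < y → ψ y = χ (a₁ ℓ)⁻¹ (ψ (y + ℓ)) := by
    intro y hy
    simp only [ψ]
    rw [map_sub, ← fastOne_eq_map_add hℓ hs hs' hB₂ (by linarith), hf, zeroExt_toFast_snd φ hy,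
      alpha_a₁_inv]
    abel
  obtain ⟨c, hc⟩ := hφ.2
  obtain ⟨c', hc'⟩ := isBigO_fastOne (χ := χ) hℓ hs hs' hB₂
  have hO : (fun y : ℝ => ψ y - (y : ℂ) ^ (1 - 2 * s) • (c - c')) =O[atTop]
      fun y : ℝ => (y : ℂ) ^ (-2 * s) := by
    refine ((hc.sub (isBigO_zeroExt_of_mem_holB₂ hℓ hB₂)).sub hc').congr_left fun y => ?_
    simp only [ψ, smul_sub]
    abel
  have h0 := eq_zero_of_quasiperiodic (by linarith) hs hs' hψ hO (by linarith : ℓ - 1 < x + ℓ)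
  rw [fastOne_eq_map_add hℓ hs hs' hB₂ hx, ← sub_eq_zero.mp h0]

lemma toFast_mem [FiniteDimensional ℂ V] (hℓ : 2 < ℓ) (hs : 0 < s.re) (hs' : s ≠ 1 / 2)
    {φ : Ioi (-1 : ℝ) → V} (hφ : φ ∈ SFEas s χ ε) : toFast s χ φ ∈ FFE s χ ε := by
  refine ⟨⟨toFast_fst_mem hℓ hφ.1, toFast_snd_mem hℓ hφ.1⟩, fun x => ?_,
    fun x => congrFun (toFast_snd_eq hℓ hφ.1) x⟩
  have hx : -1 < (x : ℝ) := x.2.1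
  refine ⟨_, hasFastOne_fastOne hℓ (toFast_snd_mem hℓ hφ.1) hx, ?_⟩
  rw [fastOne_toFast_snd hℓ hs hs' hφ hx,
    hyp_congr s χ ε (fun y hy => zeroExt_toFast_fst φ hy) (by linarith)]
  exact zeroExt_eq_of_mem_SFE hφ.1 hx

lemma toSlow_toFast [FiniteDimensional ℂ V] (hℓ : 2 < ℓ) (hs : 0 < s.re) (hs' : s ≠ 1 / 2)
    {φ : Ioi (-1 : ℝ) → V} (hφ : φ ∈ SFEas s χ ε) : toSlow s χ ε (toFast s χ φ) = φ := by
  funext x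
  have hx : -1 < (x : ℝ) := x.2
  rw [toSlow, fastOne_toFast_snd hℓ hs hs' hφ hx,
    hyp_congr s χ ε (fun y hy => zeroExt_toFast_fst φ hy) (by linarith),
    ← zeroExt_eq_of_mem_SFE hφ.1 hx]
  exact zeroExt_of_mem φ x.2

lemma toFast_toSlow [FiniteDimensional ℂ V] (hℓ : 2 < ℓ) (hs : 0 < s.re) (hs' : s ≠ 1 / 2)
    {f : (Ioo (-1 : ℝ) 1 → V) × (Ioi (ℓ - 1) → V)} (hf : f ∈ FFE s χ ε) :
    toFast s χ (toSlow s χ ε f) = f := by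
  have hfst : (toFast s χ (toSlow s χ ε f)).1 = f.1 := by
    funext x
    exact (zeroExt_toSlow_of_mem_Ioo hs hs' hf x.2).trans (zeroExt_of_mem f.1 x.2)
  refine Prod.ext hfst ?_
  rw [toFast_snd_eq hℓ (toSlow_mem hℓ hs hs' hf).1, hfst]
  funext x
  exact (hf.2.2 x).symm

/-- The isomorphism from slow to fast eigenfunctions. -/
def slowEquivFast [FiniteDimensional ℂ V] (χ : triangleGroup ℓ →* (V ≃ₗᵢ[ℂ] V)) (ε : ℤˣ)
    (hℓ : 2 < ℓ) (hs : 0 < s.re) (hs' : s ≠ 1 / 2) : SFEas s χ ε ≃ₗ[ℂ] FFE s χ ε where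
  toLinearMap := (toFast s χ).restrict fun _ hφ => toFast_mem hℓ hs hs' hφ
  invFun f := ⟨toSlow s χ ε f, toSlow_mem hℓ hs hs' f.2⟩
  left_inv φ := Subtype.ext (toSlow_toFast hℓ hs hs' φ.2)
  right_inv f := Subtype.ext (toFast_toSlow hℓ hs hs' f.2)

end Correspondence

end HeckeTriangle

end

theorem mainTheorem3 {V : Type*} [NormedAddCommGroup V] [InnerProductSpace ℂ V]
    [FiniteDimensional ℂ V] (ℓ : ℝ) (hℓ : 2 < ℓ)
    (χ : triangleGroup ℓ →* (V ≃ₗᵢ[ℂ] V)) (s : ℂ) (hs : 0 < s.re) (hs' : s ≠ 1 / 2) (ε : ℤˣ) :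
    ∃ Φ : FFE s χ ε ≃ₗ[ℂ] SFEas s χ ε,
      (∀ f : FFE s χ ε,
        (∀ x ∈ Ioo (-1 : ℝ) 1, zeroExt (Φ f : Ioi (-1 : ℝ) → V) x =
          zeroExt (f : (Ioo (-1 : ℝ) 1 → V) × (Ioi (ℓ - 1) → V)).1 x) ∧
        (∀ x ∈ Ioi (ℓ - 1), ∃ v : V,
          HasFastOne s χ (f : (Ioo (-1 : ℝ) 1 → V) × (Ioi (ℓ - 1) → V)).2 x v ∧
          zeroExt (Φ f : Ioi (-1 : ℝ) → V) x =
            zeroExt (f : (Ioo (-1 : ℝ) 1 → V) × (Ioi (ℓ - 1) → V)).2 x + v)) ∧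
      (∀ φ : SFEas s χ ε,
        (∀ x ∈ Ioo (-1 : ℝ) 1,
          zeroExt (Φ.symm φ : (Ioo (-1 : ℝ) 1 → V) × (Ioi (ℓ - 1) → V)).1 x =
            zeroExt (φ : Ioi (-1 : ℝ) → V) x) ∧
        (∀ x ∈ Ioi (ℓ - 1),
          zeroExt (Φ.symm φ : (Ioo (-1 : ℝ) 1 → V) × (Ioi (ℓ - 1) → V)).2 x =
            zeroExt (φ : Ioi (-1 : ℝ) → V) x -
              alpha s χ (a₁ ℓ)⁻¹ (φ : Ioi (-1 : ℝ) → V) x)) := by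
  refine ⟨(slowEquivFast χ ε hℓ hs hs').symm, fun f => ⟨fun x hx => ?_, fun x hx => ?_⟩,
    fun φ => ⟨fun x hx => ?_, fun x hx => ?_⟩⟩
  · exact zeroExt_toSlow_of_mem_Ioo hs hs' f.2 hx
  · have hx' : ℓ - 1 < x := hx
    exact ⟨_, hasFastOne_fastOne hℓ f.2.1.2 (by linarith), zeroExt_toSlow_of_lt hℓ f.2 hx⟩
  · exact zeroExt_toFast_fst _ hx
  · exact zeroExt_toFast_snd _ hx
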